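/- Let $\mathcal H$ be a separable complex Hilbert space (of finite or infinite dimension) and let $C, X, A$ denote bounded linear operators on $\mathcal H$. Write $\mathcal U(C)=\{UCU^*: U \text{ unitary on } \mathcal H\}$ for the unitary orbit of $C$. For a compact operator $T$, let $\lambda(T)=(\lambda_n(T))_{n\ge 1}$ be its eigenvalue sequence: the nonzero eigenvalues of $T$ listed in order of decreasing modulus and repeated according to algebraic multiplicity, followed by zeros if there are only finitely many of them (so that $0$ does not occur if there are infinitely many); it is determined up to a permutation of entries of equal modulus. Let $\|T\|_1=\operatorname{Tr}|T|$ be the trace norm, and let $\mathcal O(C)$ be the trace-norm closure of $\mathcal U(C)$ in the trace-class operators. For $C$ trace-class let $W_C(A)=\{\operatorname{Tr}(XA): X\in\mathcal U(C)\}$ and $W_{\mathcal O(C)}(A)=\{\operatorname{Tr}(XA): X\in\mathcal O(C)\}$. Let $\mathcal K$ be any infinite-dimensional separable complex Hilbert space and $\mathbf 0$ the zero operator on $\mathcal K$. (a) If $C$ is compact and normal, then for every bounded operator $X$ on $\mathcal H$ the following are equivalent: 1. $X$ lies in the operator-norm closure $\overline{\mathcal U(C)}^{\|\cdot\|}$;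 2. $X$ is compact and normal, and $\lambda(X)=\lambda(C)$ up to a permutation; 3. $X\oplus\mathbf 0\in\mathcal U(C\oplus\mathbf 0)$, as operators on $\mathcal H\oplus\mathcal K$. If in addition $C$ is trace-class, then these are also equivalent to 4. $X\in\mathcal O(C)$. (b) If $C$ has finite rank (normal or not), then $$\overline{\mathcal U(C)}^{\|\cdot\|}=\mathcal O(C)=\mathcal U(C),$$ and consequently $W_{\mathcal O(C)}(A)=W_C(A)$ for every bounded operator $A$ on $\mathcal H$. -/

import Mathlib

open scoped ENNReal InnerProductSpace

namespace OrbitClosure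

section Definitions

variable {H : Type*} [NormedAddCommGroup H] [InnerProductSpace ℂ H]

/-- `IsEigenvalueSequence T μ`: `μ` is an eigenvalue sequence `λ(T)` of the compact operator `T`.
Its moduli decrease and every `z ≠ 0` is listed as often as its algebraic multiplicity (the
dimension of the space of generalized eigenvectors) says. Consequently the sequence ends in zeros
if there are only finitely many nonzero eigenvalues, counted with multiplicity, and otherwise it
has no zero entry. Eigenvalues of equal modulus may be listed in any order. -/
def IsEigenvalueSequence (T : H →L[ℂ] H) (μ : ℕ → ℂ) : Prop :=
  Antitone (fun n => ‖μ n‖) ∧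
    ∀ z : ℂ, z ≠ 0 → {n : ℕ | μ n = z}.encard =
      Cardinal.toENat (Module.rank ℂ (Module.End.maxGenEigenspace (T : H →ₗ[ℂ] H) z))

/-- `λ(S) = λ(T)` up to a permutation. -/
def EigenvalueSequencesAgree (S T : H →L[ℂ] H) : Prop :=
  ∃ μ ν : ℕ → ℂ, IsEigenvalueSequence S μ ∧ IsEigenvalueSequence T ν ∧
    ∃ σ : Equiv.Perm ℕ, μ ∘ σ = ν

/-- The orthogonal direct sum `S ⊕ T`, acting on the Hilbert space direct sum of `H` and `K`. -/
noncomputable def directSum {K : Type*} [NormedAddCommGroup K] [InnerProductSpace ℂ K]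
    (S : H →L[ℂ] H) (T : K →L[ℂ] K) : WithLp 2 (H × K) →L[ℂ] WithLp 2 (H × K) :=
  (WithLp.prodContinuousLinearEquiv 2 ℂ H K).symm.toContinuousLinearMap ∘L
    S.prodMap T ∘L (WithLp.prodContinuousLinearEquiv 2 ℂ H K).toContinuousLinearMap

lemma ofReal_norm_sq_eq_tsum {ι : Type*} (b : HilbertBasis ι ℂ H) (x : H) :
    ENNReal.ofReal (‖x‖ ^ 2) = ∑' i, ENNReal.ofReal (‖⟪b i, x⟫_ℂ‖ ^ 2) := by
  have h : HasSum (fun i => ‖⟪b i, x⟫_ℂ‖ ^ 2) (‖x‖ ^ 2) := by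
    have h := (RCLike.hasSum_re ℂ (b.hasSum_inner_mul_inner x x))
    simp only [inner_self_eq_norm_sq] at h
    convert h using 2 with i
    rw [← inner_conj_symm x (b i), RCLike.conj_mul]
    norm_cast
  rw [← h.tsum_eq, ENNReal.ofReal_tsum_of_nonneg (fun _ => by positivity) h.summable]

variable [CompleteSpace H]

/-- The unitary orbit `𝒰(C) = {U C U* : U unitary}`. -/
def unitaryOrbit (C : H →L[ℂ] H) : Set (H →L[ℂ] H) :=
  {X | ∃ U ∈ unitary (H →L[ℂ] H), X = U * C * star U}

variable (H) in
/-- The index set of a chosen orthonormal basis of `H`. -/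
noncomputable def onbIndex : Set H := (exists_hilbertBasis ℂ H).choose

variable (H) in
/-- A chosen orthonormal basis of `H`. -/
noncomputable def onb : HilbertBasis (onbIndex H) ℂ H :=
  (exists_hilbertBasis ℂ H).choose_spec.choose

/-- The trace norm `‖T‖₁ = Tr |T| = ∑ ⟨e_i, |T| e_i⟩ ∈ [0, ∞]`, where `|T| = (T* T)^{1/2}`. The
terms are nonnegative; the sum does not depend on the basis, see `traceNorm_eq_tsum`. -/
noncomputable def traceNorm (T : H →L[ℂ] H) : ℝ≥0∞ :=
  ∑' i, ENNReal.ofReal (RCLike.re ⟪onb H i, CFC.abs T (onb H i)⟫_ℂ)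

/-- `T` is trace-class. -/
def IsTraceClass (T : H →L[ℂ] H) : Prop := traceNorm T < ∞

/-- The trace `Tr T = ∑ ⟨e_i, T e_i⟩` of a trace-class operator `T` (for these the sum converges
absolutely and does not depend on the orthonormal basis). -/
noncomputable def opTrace (T : H →L[ℂ] H) : ℂ := ∑' i, ⟪onb H i, T (onb H i)⟫_ℂ

/-- The orbit `𝒪(C)` of a trace-class operator `C`: the closure of `𝒰(C)` with respect to the
trace norm, in the space of trace-class operators. -/
def traceOrbit (C : H →L[ℂ] H) : Set (H →L[ℂ] H) :=
  {X | IsTraceClass X ∧ ∀ ε : ℝ≥0∞, 0 < ε → ∃ Y ∈ unitaryOrbit C, traceNorm (X - Y) < ε}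

/-- The `C`-numerical range `W_C(A) = {Tr (X A) : X ∈ 𝒰(C)}`. -/
def numericalRange (C A : H →L[ℂ] H) : Set ℂ := {z | ∃ X ∈ unitaryOrbit C, z = opTrace (X * A)}

/-- The orbit-closed `C`-numerical range `W_{𝒪(C)}(A) = {Tr (X A) : X ∈ 𝒪(C)}`. -/
def orbitClosedNumericalRange (C A : H →L[ℂ] H) : Set ℂ :=
  {z | ∃ X ∈ traceOrbit C, z = opTrace (X * A)}

lemma tsum_norm_sq_swap (S : H →L[ℂ] H) {ι κ : Type*}
    (b : HilbertBasis ι ℂ H) (c : HilbertBasis κ ℂ H) :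
    ∑' i, ENNReal.ofReal (‖S (b i)‖ ^ 2) =
      ∑' j, ENNReal.ofReal (‖ContinuousLinearMap.adjoint S (c j)‖ ^ 2) := by
  simp_rw [fun i => ofReal_norm_sq_eq_tsum c (S (b i)),
    fun j => ofReal_norm_sq_eq_tsum b (ContinuousLinearMap.adjoint S (c j))]
  rw [ENNReal.tsum_comm]
  refine tsum_congr fun j => tsum_congr fun i => ?_
  rw [ContinuousLinearMap.adjoint_inner_right, norm_inner_symm]

/-- The trace norm does not depend on the orthonormal basis. -/
theorem traceNorm_eq_tsum (T : H →L[ℂ] H) {ι : Type*} (b : HilbertBasis ι ℂ H) :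
    traceNorm T = ∑' i, ENNReal.ofReal (RCLike.re ⟪b i, CFC.abs T (b i)⟫_ℂ) := by
  set S := CFC.sqrt (CFC.abs T) with hS
  have hsa : ContinuousLinearMap.adjoint S = S := (CFC.sqrt_nonneg (CFC.abs T)).isSelfAdjoint
  have hsq : S * S = CFC.abs T := CFC.sqrt_mul_sqrt_self _ (CFC.abs_nonneg T)
  have h : ∀ x : H, RCLike.re ⟪x, CFC.abs T x⟫_ℂ = ‖S x‖ ^ 2 := by
    intro x
    rw [← hsq, ContinuousLinearMap.mul_def, ContinuousLinearMap.comp_apply, ← ContinuousLinearMap.adjoint_inner_left, hsa,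
      inner_self_eq_norm_sq]
  simp_rw [traceNorm, h]
  rw [tsum_norm_sq_swap S (onb H) b, hsa]

end Definitions

end OrbitClosure

/-! Compact normal operators are diagonal in an orthonormal basis with entries tending to `0`, so
everything reduces to comparing, for each `z`, how often `z` occurs on the two diagonals. Norm
limits remember this number for `z ≠ 0` only: the multiplicity of `0` can change.

For `z ≠ 0`, a gap separates `z` from the other diagonal entries, so nearby operators have no larger
`z`-eigenspace (`IsDiagonal.exists_rank_eigenspace_le`). Applied at `X` and, after conjugating back,
at `C`, this makes the multiplicities equal (`sameMultiplicities_of_mem_closure`). Conversely, equal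
nonzero multiplicities give a bijection of the supports of the diagonals. It need not extend to the
full index sets, but its restriction to any finite set does. Matching the finitely many large
entries leaves a small error in norm, and also in trace norm when the entries are summable. The
trace norm dominates the operator norm, so both closures agree. Adding an infinite-dimensional zero
summand makes both kernels infinite-dimensional, and the diagonals then match exactly.

A finite-rank `C` need not be diagonalizable. It is determined by its action on the
finite-dimensional space `M = ran C + ran C*`. If `Uₙ C Uₙ*` converges to `X`, compactness of `X`
and `X*` makes `Uₙ` converge pointwise on `M` along an ultrafilter. The limit is an isometry of `M`,
it extends to a unitary `U₀`, and `X = U₀ C U₀*` (`mem_unitaryOrbit_of_mem_closure`). -/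

namespace OrbitClosure

universe u v

open Module Module.End ContinuousLinearMap Filter Topology

/-! ### Spectral theorem for compact normal operators -/

section Spectral

variable {H : Type*} [NormedAddCommGroup H] [InnerProductSpace ℂ H]

/-- `T - z` is again normal, and a normal operator has the same kernel as its adjoint. -/
lemma _root_.IsStarNormal.adjoint_apply_of_mem_eigenspace [CompleteSpace H] {T : H →L[ℂ] H}
    (hT : IsStarNormal T) {z : ℂ} {x : H} (hx : x ∈ eigenspace (T : End ℂ H) z) :
    adjoint T x = (starRingEnd ℂ z) • x := by
  have hN : IsStarNormal (T - z • (1 : H →L[ℂ] H)) := by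
    refine ⟨?_⟩
    have h1 : Commute (star T) T := hT.star_comm_self
    rw [star_sub, star_smul, star_one]
    exact ((h1.sub_right ((Commute.one_right _).smul_right z)).sub_left
      (((Commute.one_left T).sub_right ((Commute.one_right _).smul_right z)).smul_left _))
  have h := (hN.adjoint_apply_eq_zero_iff x).2 (by
    simpa [sub_eq_zero] using mem_eigenspace_iff.1 hx)
  have h2 : adjoint (T - z • (1 : H →L[ℂ] H)) = adjoint T - (starRingEnd ℂ z) • 1 := by
    rw [← star_eq_adjoint, star_sub, star_smul, star_one, star_eq_adjoint]; rfl
  rw [h2] at h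
  simpa [sub_eq_zero] using h

lemma _root_.IsStarNormal.orthogonalFamily_eigenspaces [CompleteSpace H] {T : H →L[ℂ] H}
    (hT : IsStarNormal T) :
    OrthogonalFamily ℂ (fun z => eigenspace (T : End ℂ H) z)
      fun z => (eigenspace (T : End ℂ H) z).subtypeₗᵢ := by
  rintro z w hzw ⟨x, hx⟩ ⟨y, hy⟩
  have h1 := hT.adjoint_apply_of_mem_eigenspace hx
  have h2 : T y = w • y := mem_eigenspace_iff.1 hy
  have h3 : ⟪adjoint T x, y⟫_ℂ = ⟪x, T y⟫_ℂ := adjoint_inner_left T y x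
  rw [h1, h2, inner_smul_left, inner_smul_right] at h3
  simp only [Complex.conj_conj] at h3
  have h4 : (z - w) * ⟪x, y⟫_ℂ = 0 := by linear_combination h3
  simpa [sub_eq_zero, hzw] using h4

/-- The norm of a normal operator is its spectral radius, and nonzero spectral values of a compact
operator are eigenvalues. -/
lemma eq_zero_of_forall_not_hasEigenvalue [CompleteSpace H] {T : H →L[ℂ] H}
    (hT : IsStarNormal T) (hc : IsCompactOperator T)
    (h : ∀ z ≠ 0, ¬ HasEigenvalue (T : End ℂ H) z) : T = 0 := by
  rw [← nnnorm_eq_zero, ← ENNReal.coe_eq_zero, ← IsStarNormal.spectralRadius_eq_nnnorm T,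
    spectralRadius, ENNReal.iSup_eq_zero]
  intro z
  rw [ENNReal.iSup_eq_zero]
  intro hz
  by_contra hz0
  have hz0 : z ≠ 0 := by simpa using hz0
  exact h z hz0 ((hc.hasEigenvalue_iff_mem_spectrum hz0).2 hz)

/-- The eigenspaces of a compact normal operator have trivial orthogonal complement. -/
lemma orthogonal_iSup_eigenspaces_eq_bot [CompleteSpace H] {T : H →L[ℂ] H}
    (hT : IsStarNormal T) (hc : IsCompactOperator T) :
    (⨆ z, eigenspace (T : End ℂ H) z)ᗮ = ⊥ := by
  set M := (⨆ z, eigenspace (T : End ℂ H) z)ᗮ with hM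
  have hmem : ∀ y, y ∈ M ↔ ∀ z, ∀ x ∈ eigenspace (T : End ℂ H) z, ⟪x, y⟫_ℂ = 0 := by
    intro y
    rw [hM, ← Submodule.iInf_orthogonal]
    simp [Submodule.mem_iInf, Submodule.mem_orthogonal]
  have hinv : ∀ y ∈ M, T y ∈ M := by
    intro y hy
    rw [hmem] at hy ⊢
    intro z x hx
    rw [← adjoint_inner_left, hT.adjoint_apply_of_mem_eigenspace hx, inner_smul_left, hy z x hx,
      mul_zero]
  have hinv' : ∀ y ∈ M, adjoint T y ∈ M := by
    intro y hy
    rw [hmem] at hy ⊢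
    intro z x hx
    have h2 : T x = z • x := mem_eigenspace_iff.1 hx
    rw [adjoint_inner_right, h2, inner_smul_left, hy z x hx, mul_zero]
  have hMc : CompleteSpace M := by
    rw [hM]; infer_instance
  -- `S` is compact and normal, and an eigenvector of `S` would be an eigenvector of `T` orthogonal
  -- to itself. So `S = 0`, which puts `M` inside `ker T`, itself an eigenspace.
  let S : M →L[ℂ] M := T.restrict hinv
  have hSc : IsCompactOperator S := hc.restrict' hinv
  have hSadj : adjoint S = (adjoint T).restrict hinv' := by
    symm
    rw [eq_adjoint_iff]
    intro x y
    change ⟪adjoint T (x : H), (y : H)⟫_ℂ = ⟪(x : H), T y⟫_ℂ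
    exact adjoint_inner_left _ _ _
  have hSn : IsStarNormal S := by
    rw [isStarNormal_iff_norm_eq_adjoint] at hT ⊢
    intro v
    rw [hSadj]
    exact hT v
  have heig : ∀ z, ¬ HasEigenvalue (S : End ℂ M) z := by
    intro z hz
    obtain ⟨v, hv, hv0⟩ := hz.exists_hasEigenvector
    have h1 : T (v : H) = z • (v : H) := congrArg Subtype.val (mem_eigenspace_iff.1 hv)
    have h2 := (hmem v).1 v.2 z v (mem_eigenspace_iff.2 h1)
    exact hv0 (Subtype.ext (inner_self_eq_zero.1 h2))
  have hS0 : S = 0 :=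
    eq_zero_of_forall_not_hasEigenvalue hSn hSc fun z _ => heig z
  rw [eq_bot_iff]
  intro y hy
  have h1 : T y = 0 := by
    have := congrArg (fun R : M →L[ℂ] M => ((R ⟨y, hy⟩ : M) : H)) hS0
    exact this
  have h2 := (hmem y).1 hy 0 y (mem_eigenspace_iff.2 (by simpa using h1))
  simpa using h2

/-- `T` is diagonal with respect to `b`, with diagonal entries `f`. -/
def IsDiagonal {ι : Type*} (T : H →L[ℂ] H) (b : HilbertBasis ι ℂ H) (f : ι → ℂ) : Prop :=
  ∀ i, T (b i) = f i • b i

/-- The spectral theorem for compact normal operators. -/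
theorem exists_isDiagonal {H : Type u} [NormedAddCommGroup H] [InnerProductSpace ℂ H]
    [CompleteSpace H] {T : H →L[ℂ] H} (hT : IsStarNormal T) (hc : IsCompactOperator T) :
    ∃ (ι : Type u) (b : HilbertBasis ι ℂ H) (f : ι → ℂ), IsDiagonal T b f := by
  have hcl : ∀ z, CompleteSpace (eigenspace (T : End ℂ H) z) := by
    intro z
    have : IsClosed (eigenspace (T : End ℂ H) z : Set H) := by
      have : (eigenspace (T : End ℂ H) z : Set H) = {x | T x = z • x} := by
        ext x; exact mem_eigenspace_iff
      rw [this]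
      exact isClosed_eq T.continuous (continuous_const_smul z)
    exact this.completeSpace_coe
  choose w b hb using fun z => exists_hilbertBasis ℂ (eigenspace (T : End ℂ H) z)
  set v : (Σ z, w z) → H := fun a => (b a.1 a.2 : H) with hv
  have hon : Orthonormal ℂ v := hT.orthogonalFamily_eigenspaces.orthonormal_sigma_orthonormal
    (v_family := fun z => b z) (fun z => (b z).orthonormal)
  have hbot : (Submodule.span ℂ (Set.range v))ᗮ = ⊥ := by
    rw [← orthogonal_iSup_eigenspaces_eq_bot hT hc]
    refine le_antisymm ?_ (Submodule.orthogonal_le ?_)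
    · intro y hy
      rw [← Submodule.iInf_orthogonal, Submodule.mem_iInf]
      intro z x hx
      have : ∀ u : eigenspace (T : End ℂ H) z, ⟪(u : H), y⟫_ℂ = 0 := by
        have hd : Dense (Submodule.span ℂ (Set.range (b z)) : Set (eigenspace (T : End ℂ H) z)) :=
          Submodule.dense_iff_topologicalClosure_eq_top.2 (b z).dense_span
        have hE : (innerSL ℂ y) ∘L (eigenspace (T : End ℂ H) z).subtypeL = 0 := by
          refine ContinuousLinearMap.ext_on hd ?_
          rintro _ ⟨i, rfl⟩
          have := hy (v ⟨z, i⟩) (Submodule.subset_span ⟨_, rfl⟩)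
          simpa [hv] using inner_eq_zero_symm.1 this
        intro u
        exact inner_eq_zero_symm.1 (by simpa using congrArg (fun L => L u) hE)
      exact this ⟨x, hx⟩
    · rw [Submodule.span_le]
      rintro _ ⟨⟨z, i⟩, rfl⟩
      exact Submodule.mem_iSup_of_mem z (b z i).2
  refine ⟨Σ z, w z, HilbertBasis.mkOfOrthogonalEqBot hon hbot, fun a => a.1, ?_⟩
  rintro ⟨z, i⟩
  rw [HilbertBasis.coe_mkOfOrthogonalEqBot]
  exact mem_eigenspace_iff.1 (b z i).2

end Spectral

/-! ### Diagonal operators: eigenspaces, decay of entries, semicontinuity of multiplicities -/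

section Diagonal

variable {H : Type u} [NormedAddCommGroup H] [InnerProductSpace ℂ H] {ι : Type v}
  {T : H →L[ℂ] H} {b : HilbertBasis ι ℂ H} {f : ι → ℂ}

lemma _root_.HilbertBasis.dense_span_range (b : HilbertBasis ι ℂ H) :
    Dense (Submodule.span ℂ (Set.range b) : Set H) :=
  Submodule.dense_iff_topologicalClosure_eq_top.2 b.dense_span

lemma _root_.HilbertBasis.eq_zero_of_inner (b : HilbertBasis ι ℂ H) {x : H}
    (h : ∀ i, ⟪b i, x⟫_ℂ = 0) : x = 0 := by
  have h1 := ofReal_norm_sq_eq_tsum b x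
  simp only [h, norm_zero] at h1
  simpa using h1

lemma _root_.HilbertBasis.norm_eq_one (b : HilbertBasis ι ℂ H) (i : ι) : ‖b i‖ = 1 :=
  b.orthonormal.norm_eq_one i

lemma _root_.HilbertBasis.summable_norm_inner_sq (b : HilbertBasis ι ℂ H) (x : H) :
    Summable fun i => ‖⟪b i, x⟫_ℂ‖ ^ 2 := b.orthonormal.inner_products_summable x

lemma IsDiagonal.inner_apply (h : IsDiagonal T b f) (i : ι) (x : H) :
    ⟪b i, T x⟫_ℂ = f i * ⟪b i, x⟫_ℂ := by
  classical
  have hE : (innerSL ℂ (b i)) ∘L T = f i • innerSL ℂ (b i) := by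
    refine ContinuousLinearMap.ext_on b.dense_span_range ?_
    rintro _ ⟨j, rfl⟩
    have hij := orthonormal_iff_ite.1 b.orthonormal i j
    by_cases hj : i = j
    · subst hj; simp [h i]
    · simp [h j, hij, hj]
  simpa using congrArg (fun L => L x) hE

lemma IsDiagonal.mem_eigenspace_iff (h : IsDiagonal T b f) {z : ℂ} {x : H} :
    x ∈ eigenspace (T : End ℂ H) z ↔ ∀ i, f i ≠ z → ⟪b i, x⟫_ℂ = 0 := by
  rw [Module.End.mem_eigenspace_iff]
  constructor
  · intro hx i hi
    have h1 := h.inner_apply i x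
    change T x = z • x at hx
    rw [hx, inner_smul_right] at h1
    have h2 : (f i - z) * ⟪b i, x⟫_ℂ = 0 := by linear_combination -h1
    simpa [sub_eq_zero, hi] using h2
  · intro hx
    change T x = z • x
    rw [← sub_eq_zero]
    refine b.eq_zero_of_inner fun i => ?_
    rw [inner_sub_right, inner_smul_right, h.inner_apply]
    by_cases hi : f i = z
    · rw [hi, sub_self]
    · rw [hx i hi]; simp

/-- `(T - z) ^ k` multiplies the `i`-th coordinate by `(f i - z) ^ k`, which vanishes only if `f i =
z` or `k = 0`. -/
lemma IsDiagonal.maxGenEigenspace_eq (h : IsDiagonal T b f) (z : ℂ) :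
    maxGenEigenspace (T : End ℂ H) z = eigenspace (T : End ℂ H) z := by
  refine le_antisymm ?_ eigenspace_le_maxGenEigenspace
  intro x hx
  rw [mem_maxGenEigenspace] at hx
  obtain ⟨k, hk⟩ := hx
  rw [h.mem_eigenspace_iff]
  intro i hi
  have key : ∀ (k : ℕ) (y : H), ⟪b i, (((T : End ℂ H) - z • 1) ^ k) y⟫_ℂ
      = (f i - z) ^ k * ⟪b i, y⟫_ℂ := by
    intro k
    induction k with
    | zero => simp
    | succ k ih =>
      intro y
      rw [pow_succ, Module.End.mul_apply, ih]
      have : (((T : End ℂ H) - z • 1) y) = T y - z • y := rfl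
      rw [this, inner_sub_right, inner_smul_right, h.inner_apply]
      ring
  have h1 := key k x
  rw [hk, inner_zero_right] at h1
  have h2 : f i - z ≠ 0 := sub_ne_zero.2 hi
  simpa [h2] using h1.symm

/-- The dimension of an eigenspace of a diagonal operator. -/
lemma IsDiagonal.toENat_rank_eigenspace (h : IsDiagonal T b f) (z : ℂ) :
    Cardinal.toENat (Module.rank ℂ (eigenspace (T : End ℂ H) z)) = {i | f i = z}.encard := by
  classical
  have hmem : ∀ i : {i | f i = z}, b i ∈ eigenspace (T : End ℂ H) z := by
    rintro ⟨i, hi⟩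
    have := h i
    rw [hi] at this
    exact Module.End.mem_eigenspace_iff.2 this
  set w : {i | f i = z} → eigenspace (T : End ℂ H) z := fun i => ⟨b i, hmem i⟩ with hw
  have hli : LinearIndependent ℂ w := by
    refine LinearIndependent.of_comp (eigenspace (T : End ℂ H) z).subtype ?_
    exact b.orthonormal.linearIndependent.comp _ Subtype.val_injective
  by_cases hfin : {i | f i = z}.Finite
  · have hspan : ⊤ ≤ Submodule.span ℂ (Set.range w) := by
      rintro ⟨x, hx⟩ -
      have := hfin.fintype
      have hxs : (⟨x, hx⟩ : eigenspace (T : End ℂ H) z) = ∑ i : {i | f i = z}, ⟪b i, x⟫_ℂ • w i := by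
        apply Subtype.ext
        rw [← sub_eq_zero]
        refine b.eq_zero_of_inner fun j => ?_
        simp only [hw, Submodule.coe_sum, Submodule.coe_smul, inner_sub_right, inner_sum,
          inner_smul_right, orthonormal_iff_ite.1 b.orthonormal]
        by_cases hj : f j = z
        · rw [Finset.sum_eq_single ⟨j, hj⟩]
          · simp
          · rintro ⟨i, hi⟩ - hne
            have : j ≠ i := fun e => hne (Subtype.ext e.symm)
            simp [this]
          · simp
        · rw [h.mem_eigenspace_iff.1 hx j hj, Finset.sum_eq_zero]
          · simp
          · rintro ⟨i, hi⟩ -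
            have : j ≠ i := by rintro rfl; exact hj hi
            simp [this]
      rw [hxs]
      exact Submodule.sum_mem _ fun i _ => Submodule.smul_mem _ _ (Submodule.subset_span ⟨i, rfl⟩)
    have hr := (Basis.mk hli hspan).mk_eq_rank
    have := congrArg Cardinal.toENat hr
    rw [Cardinal.toENat_lift, Cardinal.toENat_lift] at this
    rw [← this]; rfl
  -- All infinite cardinals become `⊤`, so linear independence is enough and no spanning set is
  -- needed.
  · rw [Set.Infinite.encard_eq hfin, Cardinal.toENat_eq_top]
    have : Infinite {i | f i = z} := Set.infinite_coe_iff.2 hfin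
    have h1 := hli.cardinal_lift_le_rank
    have h3 : Cardinal.aleph0 ≤ Cardinal.lift.{u, v} (Cardinal.mk {i | f i = z}) := by simp
    have := h3.trans h1
    simpa using this

lemma _root_.HilbertBasis.tendsto_inner_cofinite (b : HilbertBasis ι ℂ H) (x : H) :
    Tendsto (fun i => ⟪b i, x⟫_ℂ) cofinite (𝓝 0) := by
  have h := (b.summable_norm_inner_sq x).tendsto_cofinite_zero
  rw [tendsto_zero_iff_norm_tendsto_zero]
  have h2 := h.sqrt
  simpa using h2

/-- Basis vectors tend weakly to `0`. If `T (b i)` tends to `y` along an ultrafilter, then `f i = ⟪b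
i, y⟫ + ⟪b i, T (b i) - y⟫` tends to `0`. -/
lemma IsDiagonal.tendsto_zero (h : IsDiagonal T b f) (hc : IsCompactOperator T) :
    Tendsto f cofinite (𝓝 0) := by
  rw [tendsto_iff_ultrafilter]
  intro U hU
  obtain ⟨K, hK, hTK⟩ := hc.image_closedBall_subset_compact 1
  have hmem : ∀ i, T (b i) ∈ K := fun i =>
    hTK ⟨b i, by simp [b.norm_eq_one], rfl⟩
  obtain ⟨y, -, hy⟩ := hK.ultrafilter_le_nhds (U.map fun i => T (b i))
    (le_principal_iff.2 (Ultrafilter.mem_map.2 (Eventually.of_forall hmem)))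
  have hy' : Tendsto (fun i => T (b i)) U (𝓝 y) := hy
  have h1 := (b.tendsto_inner_cofinite y).mono_left hU
  have h2 : Tendsto (fun i => ⟪b i, T (b i) - y⟫_ℂ) U (𝓝 0) := by
    refine squeeze_zero_norm (fun i => ?_) (tendsto_iff_norm_sub_tendsto_zero.1 hy')
    refine (norm_inner_le_norm _ _).trans ?_
    rw [b.norm_eq_one, one_mul]
  have h3 := h1.add h2
  rw [add_zero] at h3
  refine h3.congr fun i => ?_
  rw [← inner_add_right, add_sub_cancel, h i, inner_smul_right, inner_self_eq_norm_sq_to_K,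
    b.norm_eq_one]
  simp

lemma IsDiagonal.norm_le (h : IsDiagonal T b f) {ε : ℝ} (hε : 0 ≤ ε) (hf : ∀ i, ‖f i‖ ≤ ε) :
    ‖T‖ ≤ ε := by
  refine T.opNorm_le_bound hε fun x => ?_
  have h1 : ENNReal.ofReal (‖T x‖ ^ 2) ≤ ENNReal.ofReal ((ε * ‖x‖) ^ 2) := by
    rw [mul_pow, ENNReal.ofReal_mul (by positivity), ofReal_norm_sq_eq_tsum b,
      ofReal_norm_sq_eq_tsum b x, ← ENNReal.tsum_mul_left]
    refine ENNReal.tsum_le_tsum fun i => ?_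
    rw [← ENNReal.ofReal_mul (by positivity), h.inner_apply, norm_mul, mul_pow]
    gcongr
    exact hf i
  rw [ENNReal.ofReal_le_ofReal_iff (by positivity)] at h1
  exact le_of_sq_le_sq h1 (by positivity)

/-- Nearby operators have no larger eigenspaces for a nonzero eigenvalue. -/
lemma IsDiagonal.exists_rank_eigenspace_le (h : IsDiagonal T b f) (hc : IsCompactOperator T)
    {z : ℂ} (hz : z ≠ 0) : ∃ δ > 0, ∀ Y : H →L[ℂ] H, ‖T - Y‖ < δ →
      Cardinal.toENat (Module.rank ℂ (eigenspace (Y : End ℂ H) z)) ≤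
        Cardinal.toENat (Module.rank ℂ (eigenspace (T : End ℂ H) z)) := by
  have hev := h.tendsto_zero hc
  have hz' : 0 < ‖z‖ := norm_pos_iff.2 hz
  have hfin : {i | ¬ ‖f i‖ < ‖z‖ / 2}.Finite := by
    have := hev.norm.eventually (gt_mem_nhds (show ‖(0 : ℂ)‖ < ‖z‖ / 2 by simpa using hz'))
    exact this
  -- All but finitely many entries have modulus below `‖z‖ / 2`, hence distance at least `‖z‖ / 2`
  -- from `z`.
  obtain ⟨δ, hδ, hδf⟩ : ∃ δ > 0, ∀ i, f i ≠ z → δ ≤ ‖f i - z‖ := by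
    obtain ⟨δ, hδ, hδf⟩ : ∃ δ > 0, ∀ i ∈ hfin.toFinset, f i ≠ z → δ ≤ ‖f i - z‖ := by
      have : ∀ᶠ δ in 𝓝[>] (0 : ℝ), ∀ i ∈ hfin.toFinset, f i ≠ z → δ ≤ ‖f i - z‖ := by
        rw [Filter.eventually_all_finset]
        intro i _
        by_cases hi : f i = z
        · simp [hi]
        · have h0 : 0 < ‖f i - z‖ := norm_pos_iff.2 (sub_ne_zero.2 hi)
          filter_upwards [nhdsWithin_le_nhds (Iic_mem_nhds h0)] with δ hd _ using hd
      obtain ⟨δ, h1, h2⟩ := (this.and self_mem_nhdsWithin).exists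
      exact ⟨δ, h2, h1⟩
    refine ⟨min δ (‖z‖ / 2), lt_min hδ (by positivity), fun i hi => ?_⟩
    by_cases hif : ‖f i‖ < ‖z‖ / 2
    · refine (min_le_right _ _).trans ?_
      have := norm_sub_norm_le z (f i)
      rw [norm_sub_rev] at this
      linarith
    · exact (min_le_left _ _).trans (hδf i (by simpa using hif) hi)
  refine ⟨δ, hδ, fun Y hY => ?_⟩
  have hJfin : {i | f i = z}.Finite := hfin.subset fun i hi => by
    have : f i = z := hi
    simp only [Set.mem_ofPred_eq, this]; linarith
  have := hJfin.fintype
  let L : eigenspace (Y : End ℂ H) z →ₗ[ℂ] ({i | f i = z} → ℂ) :=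
    { toFun := fun y i => ⟪b i, (y : H)⟫_ℂ
      map_add' := fun x y => by ext i; simp
      map_smul' := fun c x => by ext i; simp }
  -- If `L y = 0`, the gap gives `δ ‖y‖ ≤ ‖(T - z) y‖ = ‖(T - Y) y‖ ≤ ‖T - Y‖ ‖y‖` with `‖T - Y‖ <
  -- δ`, so `y = 0`.
  have hL : Function.Injective L := by
    rw [← LinearMap.ker_eq_bot, LinearMap.ker_eq_bot']
    rintro ⟨y, hy⟩ hLy
    have hYy : Y y = z • y := Module.End.mem_eigenspace_iff.1 hy
    have hy0 : ∀ i, f i = z → ⟪b i, y⟫_ℂ = 0 := fun i hi => congrFun hLy ⟨i, hi⟩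
    have h1 : δ * ‖y‖ ≤ ‖T y - z • y‖ := by
      have h1 : ENNReal.ofReal ((δ * ‖y‖) ^ 2) ≤ ENNReal.ofReal (‖T y - z • y‖ ^ 2) := by
        rw [mul_pow, ENNReal.ofReal_mul (by positivity), ofReal_norm_sq_eq_tsum b,
          ofReal_norm_sq_eq_tsum b (T y - z • y), ← ENNReal.tsum_mul_left]
        refine ENNReal.tsum_le_tsum fun i => ?_
        rw [← ENNReal.ofReal_mul (by positivity), inner_sub_right, inner_smul_right, h.inner_apply,
          ← sub_mul, norm_mul, mul_pow]
        by_cases hi : f i = z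
        · simp [hy0 i hi]
        · have := hδf i hi
          gcongr
      rw [ENNReal.ofReal_le_ofReal_iff (by positivity)] at h1
      exact le_of_sq_le_sq h1 (by positivity)
    rw [← hYy] at h1
    have h2 : ‖T y - Y y‖ ≤ ‖T - Y‖ * ‖y‖ := (T - Y).le_opNorm y
    have h3 : ‖y‖ = 0 := by
      by_contra hne
      have : 0 < ‖y‖ := lt_of_le_of_ne (norm_nonneg _) (Ne.symm hne)
      nlinarith
    exact Subtype.ext (norm_eq_zero.1 h3)
  have hr := LinearMap.lift_rank_le_of_injective L hL
  rw [h.toENat_rank_eigenspace]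
  have hr' := OrderHomClass.mono (Cardinal.toENat) hr
  rw [Cardinal.toENat_lift, Cardinal.toENat_lift] at hr'
  refine hr'.trans ?_
  rw [rank_fun', Set.encard, ENat.card_eq_coe_fintype_card]
  simp

end Diagonal

/-! ### Hilbert bases of a separable space and unitaries between them -/

section Bases

variable {H : Type*} [NormedAddCommGroup H] [InnerProductSpace ℂ H]

lemma _root_.Orthonormal.countable_of_separableSpace [TopologicalSpace.SeparableSpace H]
    {ι : Type*} {v : ι → H} (hv : Orthonormal ℂ v) : Countable ι := by
  refine Pairwise.countable_of_isOpen_disjoint (s := fun i => Metric.ball (v i) (1 / 2)) ?_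
    (fun i => Metric.isOpen_ball) (fun i => ⟨v i, by simp⟩)
  intro i j hij
  refine Metric.ball_disjoint_ball ?_
  have h1 : ‖v i - v j‖ ^ 2 = 2 := by
    rw [@norm_sub_sq ℂ, hv.norm_eq_one, hv.norm_eq_one, hv.2 hij]; norm_num
  rw [dist_eq_norm]
  nlinarith [norm_nonneg (v i - v j)]

lemma nonempty_equiv_of_enatCard_eq {α β : Type*} [Countable α] [Countable β]
    (h : ENat.card α = ENat.card β) : Nonempty (α ≃ β) := by
  rcases finite_or_infinite α with hα | hα
  · have hβ : Finite β := by
      rw [← not_infinite_iff_finite]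
      intro hβ
      rw [ENat.card_eq_top_of_infinite (α := β)] at h
      exact (ENat.card_lt_top.2 hα).ne h
    have := Fintype.ofFinite α
    have := Fintype.ofFinite β
    rw [ENat.card_eq_coe_fintype_card, ENat.card_eq_coe_fintype_card] at h
    exact ⟨Fintype.equivOfCardEq (by exact_mod_cast h)⟩
  · have hβ : Infinite β := by
      rw [← not_finite_iff_infinite]
      intro hβ
      rw [ENat.card_eq_top_of_infinite (α := α)] at h
      exact (ENat.card_lt_top.2 hβ).ne h.symm
    exact nonempty_equiv_of_countable

lemma _root_.HilbertBasis.finite_of_finite {ι κ : Type*} (b : HilbertBasis ι ℂ H)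
    (c : HilbertBasis κ ℂ H) [Finite ι] : Finite κ := by
  have := Fintype.ofFinite ι
  have : FiniteDimensional ℂ H := b.toOrthonormalBasis.toBasis.finiteDimensional_of_finite
  exact c.orthonormal.linearIndependent.finite

lemma _root_.HilbertBasis.nonempty_equiv [TopologicalSpace.SeparableSpace H] {ι κ : Type*}
    (b : HilbertBasis ι ℂ H) (c : HilbertBasis κ ℂ H) : Nonempty (ι ≃ κ) := by
  have := b.orthonormal.countable_of_separableSpace
  have := c.orthonormal.countable_of_separableSpace
  rcases finite_or_infinite ι with hι | hι
  · have hκ := b.finite_of_finite c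
    have := Fintype.ofFinite ι
    have := Fintype.ofFinite κ
    exact ⟨b.toOrthonormalBasis.toBasis.indexEquiv c.toOrthonormalBasis.toBasis⟩
  · have hκ : Infinite κ := by
      rw [← not_finite_iff_infinite]
      intro hκ
      exact hι.not_finite (c.finite_of_finite b)
    exact nonempty_equiv_of_countable

lemma _root_.HilbertBasis.exists_unitary [CompleteSpace H] {ι κ : Type*}
    (b : HilbertBasis ι ℂ H) (c : HilbertBasis κ ℂ H) (e : ι ≃ κ) :
    ∃ U ∈ unitary (H →L[ℂ] H), ∀ i, U (b i) = c (e i) := by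
  classical
  have ho : Orthonormal ℂ (fun i => c (e i)) := c.orthonormal.comp e e.injective
  have hr : Set.range (fun i => c (e i)) = Set.range c := e.surjective.range_comp c
  let c' : HilbertBasis ι ℂ H := HilbertBasis.mk ho (by rw [hr, c.dense_span])
  have hc' : ∀ i, c' i = c (e i) := fun i => by
    rw [HilbertBasis.coe_mk]
  let V : H ≃ₗᵢ[ℂ] H := b.repr.trans c'.repr.symm
  refine ⟨(Unitary.linearIsometryEquiv.symm V : unitary (H →L[ℂ] H)),
    (Unitary.linearIsometryEquiv.symm V).2, fun i => ?_⟩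
  have : ((Unitary.linearIsometryEquiv.symm V : unitary (H →L[ℂ] H)) : H →L[ℂ] H) (b i) = V (b i) :=
    rfl
  rw [this, ← hc']
  change c'.repr.symm (b.repr (b i)) = _
  rw [b.repr_self, c'.repr_symm_single]

lemma star_apply_of_apply_eq [CompleteSpace H] {U : H →L[ℂ] H} (hU : U ∈ unitary (H →L[ℂ] H))
    {x y : H} (h : U x = y) : star U y = x := by
  rw [← h]
  exact congrArg (fun T : H →L[ℂ] H => T x) (Unitary.star_mul_self_of_mem hU)

end Bases

/-! ### Matching diagonal entries -/

section Matching

variable {ι κ : Type*} {f : ι → ℂ} {g : κ → ℂ}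

lemma exists_equiv_of_encard_fibers_eq [Countable ι] [Countable κ]
    (h : ∀ z, {i | f i = z}.encard = {j | g j = z}.encard) :
    ∃ e : ι ≃ κ, ∀ i, g (e i) = f i := by
  have : ∀ z, Nonempty ({i // f i = z} ≃ {j // g j = z}) := fun z =>
    nonempty_equiv_of_enatCard_eq (h z)
  exact ⟨Equiv.ofFiberEquiv fun z => (this z).some, Equiv.ofFiberEquiv_map _⟩

lemma exists_equiv_support_of_encard_fibers_eq [Countable ι] [Countable κ]
    (h : ∀ z ≠ 0, {i | f i = z}.encard = {j | g j = z}.encard) :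
    ∃ e : {i // f i ≠ 0} ≃ {j // g j ≠ 0}, ∀ i, g (e i) = f i := by
  refine exists_equiv_of_encard_fibers_eq (f := fun i : {i // f i ≠ 0} => f i)
    (g := fun j : {j // g j ≠ 0} => g j) fun z => ?_
  by_cases hz : z = 0
  · subst hz
    rw [Set.encard_eq_zero.2, Set.encard_eq_zero.2]
    · ext i; simpa using i.2
    · ext i; simpa using i.2
  · have e1 : {i : {i // f i ≠ 0} | f i = z} ≃ {i | f i = z} :=
      Equiv.subtypeSubtypeEquivSubtype (q := fun i => f i = z) (by rintro x rfl; exact hz)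
    have e2 : {i : {i // g i ≠ 0} | g i = z} ≃ {i | g i = z} :=
      Equiv.subtypeSubtypeEquivSubtype (q := fun i => g i = z) (by rintro x rfl; exact hz)
    rw [Set.encard_congr e1, Set.encard_congr e2, h z hz]

/-- Removing finite sets of the same size from equipotent sets leaves equipotent complements. For
infinite partial matchings this fails, which is why the multiplicity of `0` is lost in the closure.
-/
lemma exists_equiv_extending {α : Type*} [Finite α] {p : α → ι} {q : α → κ}
    (hp : Function.Injective p) (hq : Function.Injective q) (h : Nonempty (ι ≃ κ)) :
    ∃ π : ι ≃ κ, ∀ a, π (p a) = q a := by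
  let φ : Set.range p ↪ κ := (Equiv.ofInjective p hp).symm.toEmbedding.trans ⟨q, hq⟩
  have hφ : ∀ a, φ ⟨p a, a, rfl⟩ = q a := fun a =>
    congrArg q ((Equiv.ofInjective p hp).symm_apply_apply a)
  obtain ⟨π, hπ⟩ : ∃ π : ι ≃ κ, ∀ x : Set.range p, π x = φ x := by
    rcases finite_or_infinite ι with hι | hι
    · exact Cardinal.extend_function_finite φ h
    · exact Cardinal.extend_function_of_lt φ
        ((Cardinal.lt_aleph0_iff_set_finite.2 (Set.finite_range p)).trans_le
          (Cardinal.aleph0_le_mk ι)) h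
  exact ⟨π, fun a => (hπ ⟨p a, a, rfl⟩).trans (hφ a)⟩

lemma exists_equiv_extending_of_finite (e : {i // f i ≠ 0} ≃ {j // g j ≠ 0})
    (h : Nonempty (ι ≃ κ)) (F : Finset {i // f i ≠ 0}) :
    ∃ π : ι ≃ κ, ∀ i ∈ F, π i = e i := by
  obtain ⟨π, hπ⟩ := exists_equiv_extending (p := fun i : F => ((i : {i // f i ≠ 0}) : ι))
    (q := fun i : F => (e i : κ)) (fun _ _ hij => Subtype.ext (Subtype.ext hij))
    (fun _ _ hij => Subtype.ext (e.injective (Subtype.ext hij))) h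
  exact ⟨π, fun i hi => hπ ⟨i, hi⟩⟩

end Matching

/-! ### Operator-norm approximation by the unitary orbit -/

section Orbit

variable {H : Type*} [NormedAddCommGroup H] [InnerProductSpace ℂ H] [CompleteSpace H]
  {ι κ : Type*} {X C : H →L[ℂ] H} {b : HilbertBasis ι ℂ H} {c : HilbertBasis κ ℂ H} {f : ι → ℂ}
  {g : κ → ℂ}

/-- Conjugating with the unitary that maps one eigenbasis onto another. -/
lemma IsDiagonal.exists_unitaryOrbit (hX : IsDiagonal X b f) (hC : IsDiagonal C c g)
    (π : ι ≃ κ) : ∃ Y ∈ unitaryOrbit C, IsDiagonal (X - Y) b fun i => f i - g (π i) := by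
  obtain ⟨U, hU, hUc⟩ := c.exists_unitary b π.symm
  refine ⟨U * C * star U, ⟨U, hU, rfl⟩, fun i => ?_⟩
  have h1 : U (c (π i)) = b i := by rw [hUc, Equiv.symm_apply_apply]
  have h2 := star_apply_of_apply_eq hU h1
  have h3 : (U * C * star U) (b i) = g (π i) • b i := by
    change U (C (star U (b i))) = _
    rw [h2, hC, map_smul, h1]
  rw [sub_apply, h3, hX i, sub_smul]

lemma IsDiagonal.mem_unitaryOrbit [Countable ι] [Countable κ] (hX : IsDiagonal X b f)
    (hC : IsDiagonal C c g) (h : ∀ z, {i | f i = z}.encard = {j | g j = z}.encard) :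
    X ∈ unitaryOrbit C := by
  obtain ⟨e, he⟩ := exists_equiv_of_encard_fibers_eq h
  obtain ⟨Y, hY, hD⟩ := hX.exists_unitaryOrbit hC e
  have : ‖X - Y‖ ≤ 0 := hD.norm_le le_rfl fun i => by simp [he]
  rw [norm_le_zero_iff, sub_eq_zero] at this
  rwa [this]

/-- The bijection of the supports is followed only on the entries of modulus at least `ε / 4`. Every
other index pairs two entries below `ε / 4`, so the diagonals differ by at most `ε / 2`. -/
lemma IsDiagonal.mem_closure_unitaryOrbit [TopologicalSpace.SeparableSpace H]
    (hX : IsDiagonal X b f) (hC : IsDiagonal C c g) (hf : Tendsto f cofinite (𝓝 0))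
    (h : ∀ z ≠ 0, {i | f i = z}.encard = {j | g j = z}.encard) :
    X ∈ closure (unitaryOrbit C) := by
  have := b.orthonormal.countable_of_separableSpace
  have := c.orthonormal.countable_of_separableSpace
  obtain ⟨e, he⟩ := exists_equiv_support_of_encard_fibers_eq h
  rw [Metric.mem_closure_iff]
  intro ε hε
  have hfin : {i : {i // f i ≠ 0} | ¬ ‖f i‖ < ε / 4}.Finite := by
    have h1 : {i | ¬ ‖f i‖ < ε / 4}.Finite :=
      hf.norm.eventually (gt_mem_nhds (show ‖(0 : ℂ)‖ < ε / 4 by simpa using hε))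
    exact h1.preimage Subtype.val_injective.injOn
  obtain ⟨π, hπ⟩ := exists_equiv_extending_of_finite e (b.nonempty_equiv c) hfin.toFinset
  obtain ⟨Y, hY, hD⟩ := hX.exists_unitaryOrbit hC π
  refine ⟨Y, hY, ?_⟩
  rw [dist_eq_norm]
  refine lt_of_le_of_lt (hD.norm_le (ε := ε / 2) (by positivity) fun i => ?_) (by linarith)
  by_cases hi : ‖f i‖ < ε / 4
  -- A large `g (π i)` would be the partner of some large `f i'`. Then `π i' = π i`, so `i' = i`,
  -- although `f i` is small.
  · have hg : ‖g (π i)‖ < ε / 4 := by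
      by_contra hcon
      have h0 : g (π i) ≠ 0 := by
        intro h0; rw [h0, norm_zero] at hcon; exact hcon (by linarith)
      obtain ⟨i', hi'⟩ := e.surjective ⟨π i, h0⟩
      have h1 : f i' = g (π i) := by rw [← he i', hi']
      have h2 := hπ i' (by simpa [h1] using hcon)
      rw [hi'] at h2
      have h3 := π.injective h2
      rw [← h1, h3] at hcon
      exact hcon hi
    refine (norm_sub_le _ _).trans ?_
    linarith
  · have h0 : f i ≠ 0 := by
      intro h0; rw [h0, norm_zero] at hi; exact hi (by linarith)
    have h2 := hπ ⟨i, h0⟩ (by simpa using hi)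
    rw [h2, he ⟨i, h0⟩, sub_self, norm_zero]
    positivity

end Orbit

/-! ### The trace norm and trace-norm approximation -/

section TraceNorm

variable {H : Type*} [NormedAddCommGroup H] [InnerProductSpace ℂ H] [CompleteSpace H]

lemma norm_abs_apply (T : H →L[ℂ] H) (x : H) : ‖CFC.abs T x‖ = ‖T x‖ := by
  have h1 : adjoint (CFC.abs T) = CFC.abs T := (CFC.abs_nonneg T).isSelfAdjoint
  have h2 : (CFC.abs T) (CFC.abs T x) = adjoint T (T x) :=
    congrArg (fun S : H →L[ℂ] H => S x) (CFC.abs_mul_abs T)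
  have h3 : ‖CFC.abs T x‖ ^ 2 = ‖T x‖ ^ 2 := by
    rw [← @inner_self_eq_norm_sq ℂ, ← @inner_self_eq_norm_sq ℂ, ← adjoint_inner_right, h1, h2,
      adjoint_inner_right]
  exact (sq_eq_sq₀ (norm_nonneg _) (norm_nonneg _)).1 h3

lemma traceNorm_le_tsum_norm (T : H →L[ℂ] H) {ι : Type*} (b : HilbertBasis ι ℂ H) :
    traceNorm T ≤ ∑' i, ENNReal.ofReal ‖T (b i)‖ := by
  rw [traceNorm_eq_tsum T b]
  refine ENNReal.tsum_le_tsum fun i => ENNReal.ofReal_le_ofReal ?_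
  refine (RCLike.re_le_norm _).trans ((norm_inner_le_norm _ _).trans ?_)
  rw [b.norm_eq_one, one_mul, norm_abs_apply]

lemma traceNorm_zero : traceNorm (0 : H →L[ℂ] H) = 0 := by
  simp [traceNorm]

/-- For `S = |T| ^ (1/2)` the trace norm is the squared Hilbert–Schmidt norm of `S`, which bounds
`‖S‖ ^ 2`. Moreover `‖T x‖ = ‖S (S x)‖`. -/
lemma ofReal_norm_le_traceNorm (T : H →L[ℂ] H) : ENNReal.ofReal ‖T‖ ≤ traceNorm T := by
  by_cases htop : traceNorm T = ∞
  · simp [htop]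
  set S := CFC.sqrt (CFC.abs T) with hS
  have hsa : adjoint S = S := (CFC.sqrt_nonneg (CFC.abs T)).isSelfAdjoint
  have hsq : S * S = CFC.abs T := CFC.sqrt_mul_sqrt_self _ (CFC.abs_nonneg T)
  have hSt : traceNorm T = ∑' i, ENNReal.ofReal (‖S (onb H i)‖ ^ 2) := by
    refine tsum_congr fun i => ?_
    rw [← hsq, mul_def, comp_apply, ← adjoint_inner_left, hsa, inner_self_eq_norm_sq]
  set t := (traceNorm T).toReal with ht
  have ht' : traceNorm T = ENNReal.ofReal t := (ENNReal.ofReal_toReal htop).symm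
  have ht0 : 0 ≤ t := ENNReal.toReal_nonneg
  have key : ∀ x, ‖S x‖ ^ 2 ≤ t * ‖x‖ ^ 2 := by
    intro x
    rw [← ENNReal.ofReal_le_ofReal_iff (by positivity), ENNReal.ofReal_mul ht0, ← ht', hSt,
      ofReal_norm_sq_eq_tsum (onb H), ← ENNReal.tsum_mul_right]
    refine ENNReal.tsum_le_tsum fun i => ?_
    rw [← ENNReal.ofReal_mul (by positivity), ← mul_pow, ← adjoint_inner_left, hsa]
    gcongr
    exact norm_inner_le_norm _ _
  rw [ht']
  refine ENNReal.ofReal_le_ofReal (T.opNorm_le_bound ht0 fun x => ?_)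
  rw [← norm_abs_apply, ← hsq]
  change ‖S (S x)‖ ≤ _
  refine le_of_sq_le_sq ?_ (by positivity)
  calc ‖S (S x)‖ ^ 2 ≤ t * ‖S x‖ ^ 2 := key _
    _ ≤ t * (t * ‖x‖ ^ 2) := by gcongr; exact key x
    _ = (t * ‖x‖) ^ 2 := by ring

lemma traceOrbit_subset_closure (C : H →L[ℂ] H) : traceOrbit C ⊆ closure (unitaryOrbit C) := by
  rintro X ⟨-, hX⟩
  rw [Metric.mem_closure_iff]
  intro ε hε
  obtain ⟨Y, hY, h⟩ := hX (ENNReal.ofReal ε) (by simpa using hε)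
  refine ⟨Y, hY, ?_⟩
  rw [dist_eq_norm]
  exact (ENNReal.ofReal_lt_ofReal_iff hε).1 ((ofReal_norm_le_traceNorm _).trans_lt h)

variable {ι κ : Type*} {X C T : H →L[ℂ] H} {b : HilbertBasis ι ℂ H} {c : HilbertBasis κ ℂ H}
  {f : ι → ℂ} {g : κ → ℂ}

lemma IsDiagonal.adjoint_apply (h : IsDiagonal T b f) (i : ι) :
    adjoint T (b i) = (starRingEnd ℂ (f i)) • b i := by
  refine ext_inner_right ℂ fun x => ?_
  rw [adjoint_inner_left, h.inner_apply, inner_smul_left, Complex.conj_conj]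

/-- `|T| ^ 2` acts on `b i` as `‖f i‖ ^ 2`, so `y = |T| (b i) - ‖f i‖ b i` satisfies `|T| y = -‖f i‖
y`. Positivity of `|T|` forces `y = 0` when `f i ≠ 0`. -/
lemma IsDiagonal.abs_apply (h : IsDiagonal T b f) (i : ι) :
    CFC.abs T (b i) = (‖f i‖ : ℂ) • b i := by
  by_cases h0 : f i = 0
  · have h1 : CFC.abs T (b i) = 0 := by
      rw [← norm_eq_zero, norm_abs_apply, h i, h0]; simp
    rw [h1, h0]; simp
  have hsq : (CFC.abs T) (CFC.abs T (b i)) = ((‖f i‖ : ℂ) * ‖f i‖) • b i := by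
    have h2 : (CFC.abs T) (CFC.abs T (b i)) = adjoint T (T (b i)) :=
      congrArg (fun S : H →L[ℂ] H => S (b i)) (CFC.abs_mul_abs T)
    rw [h2, h i, map_smul, h.adjoint_apply, smul_smul, RCLike.mul_conj, sq]
    rfl
  set y := CFC.abs T (b i) - (‖f i‖ : ℂ) • b i with hy
  have h1 : CFC.abs T y = -((‖f i‖ : ℂ) • y) := by
    rw [hy, map_sub, map_smul, hsq, smul_sub, smul_smul]; abel
  have hpos : (CFC.abs T).IsPositive := (nonneg_iff_isPositive _).1 (CFC.abs_nonneg T)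
  have h2 := hpos.re_inner_nonneg_right y
  rw [h1, inner_neg_right, inner_smul_right, inner_self_eq_norm_sq_to_K] at h2
  have h3 : 0 ≤ -(‖f i‖ * ‖y‖ ^ 2) := by
    convert h2 using 1
    rw [map_neg]
    congr 1
    have h4 : (‖f i‖ : ℂ) * (‖y‖ : ℂ) ^ 2 = ((‖f i‖ * ‖y‖ ^ 2 : ℝ) : ℂ) := by push_cast; rfl
    exact (congrArg Complex.re h4).symm
  have h4 : 0 < ‖f i‖ := norm_pos_iff.2 h0
  have h5 : ‖y‖ ^ 2 = 0 := by
    by_contra hne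
    have : 0 < ‖y‖ ^ 2 := lt_of_le_of_ne (by positivity) (Ne.symm hne)
    nlinarith
  have h6 : y = 0 := by simpa using h5
  exact sub_eq_zero.1 h6

lemma IsDiagonal.traceNorm_eq (h : IsDiagonal T b f) :
    traceNorm T = ∑' i, ENNReal.ofReal ‖f i‖ := by
  rw [traceNorm_eq_tsum T b]
  refine tsum_congr fun i => ?_
  rw [h.abs_apply, inner_smul_right, inner_self_eq_norm_sq_to_K, b.norm_eq_one]
  simp

lemma tsum_ofReal_norm_eq_tsum_support (f : ι → ℂ) :
    ∑' i, ENNReal.ofReal ‖f i‖ = ∑' i : {i // f i ≠ 0}, ENNReal.ofReal ‖f i‖ := by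
  symm
  refine tsum_subtype_eq_of_support_subset (s := {i | f i ≠ 0})
    (f := fun i => ENNReal.ofReal ‖f i‖) ?_
  intro i hi h0
  exact hi (by simp [show f i = 0 from h0])

/-- After matching finitely many nonzero entries, the remaining ones are the only contribution
to the distance of the diagonals. -/
lemma tsum_ofReal_norm_sub_le (e : {i // f i ≠ 0} ≃ {j // g j ≠ 0}) (he : ∀ i, g (e i) = f i)
    (F : Finset {i // f i ≠ 0}) (π : ι ≃ κ) (hπ : ∀ i ∈ F, π i = e i) :
    ∑' i, ENNReal.ofReal ‖f i - g (π i)‖ ≤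
      2 * ∑' i : {i // i ∉ F}, ENNReal.ofReal ‖f i‖ := by
  classical
  -- `a` and `a'` are the moduli of the unmatched entries of `f` and `g`, extended by `0`. Since `e`
  -- identifies them, both have the same sum, whence the factor `2`.
  let a : ι → ℝ≥0∞ := fun i =>
    if h : f i ≠ 0 then (if ⟨i, h⟩ ∈ F then 0 else ENNReal.ofReal ‖f i‖) else 0
  let a' : κ → ℝ≥0∞ := fun j =>
    if h : g j ≠ 0 then (if e.symm ⟨j, h⟩ ∈ F then 0 else ENNReal.ofReal ‖g j‖) else 0
  have ha0 : ∀ x : {i // f i ≠ 0}, a x = if x ∈ F then 0 else ENNReal.ofReal ‖f x‖ := by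
    rintro ⟨i, hi⟩
    simp only [a, dif_pos hi]
  have hF : ∑' x : {i // f i ≠ 0}, (if x ∈ F then 0 else ENNReal.ofReal ‖f x‖) =
      ∑' i : {i // i ∉ F}, ENNReal.ofReal ‖f i‖ := by
    symm
    refine (tsum_subtype {i | i ∉ F} (fun x : {i // f i ≠ 0} => ENNReal.ofReal ‖f x‖)).trans
      (tsum_congr fun x => ?_)
    by_cases hx : x ∈ F <;> simp [hx]
  have ha : ∑' i, a i = ∑' i : {i // i ∉ F}, ENNReal.ofReal ‖f i‖ := by
    rw [← hF, ← tsum_subtype_eq_of_support_subset (s := {i | f i ≠ 0}) (f := a)]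
    · exact tsum_congr ha0
    · intro i hi h0
      exact hi (by simp only [a]; rw [dif_neg (not_not.2 h0)])
  have ha' : ∑' j, a' j = ∑' i : {i // i ∉ F}, ENNReal.ofReal ‖f i‖ := by
    rw [← hF, ← tsum_subtype_eq_of_support_subset (s := {j | g j ≠ 0}) (f := a')]
    · refine (e.tsum_eq (fun j : {j // g j ≠ 0} => a' j)).symm.trans (tsum_congr fun x => ?_)
      simp only [a', dif_pos (e x).2]
      have : e.symm ⟨(e x : κ), (e x).2⟩ = x := e.symm_apply_apply x
      rw [this, he]
    · intro j hj h0
      exact hj (by simp only [a']; rw [dif_neg (not_not.2 h0)])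
  have hle : ∀ i, ENNReal.ofReal ‖f i - g (π i)‖ ≤ a i + a' (π i) := by
    intro i
    by_cases hi : ∃ h : f i ≠ 0, (⟨i, h⟩ : {i // f i ≠ 0}) ∈ F
    · obtain ⟨h, hi⟩ := hi
      have h1 := hπ _ hi
      rw [h1, he ⟨i, h⟩]; simp
    · have h1 : ENNReal.ofReal ‖f i‖ ≤ a i := by
        by_cases h : f i ≠ 0
        · have : (⟨i, h⟩ : {i // f i ≠ 0}) ∉ F := fun hF => hi ⟨h, hF⟩
          simp only [a, dif_pos h, if_neg this, le_refl]
        · push Not at h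
          simp [h]
      have h2 : ENNReal.ofReal ‖g (π i)‖ ≤ a' (π i) := by
        by_cases h : g (π i) ≠ 0
        · have : e.symm ⟨π i, h⟩ ∉ F := by
            intro hF
            have h3 := hπ _ hF
            rw [Equiv.apply_symm_apply] at h3
            have h4 : ((e.symm ⟨π i, h⟩ : {i // f i ≠ 0}) : ι) = i := π.injective h3
            exact hi ⟨h4 ▸ (e.symm ⟨π i, h⟩).2, by convert hF; exact h4.symm⟩
          simp only [a', dif_pos h, if_neg this, le_refl]
        · push Not at h
          simp [h]
      refine (ENNReal.ofReal_le_ofReal (norm_sub_le _ _)).trans ?_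
      rw [ENNReal.ofReal_add (norm_nonneg _) (norm_nonneg _)]
      exact add_le_add h1 h2
  calc ∑' i, ENNReal.ofReal ‖f i - g (π i)‖ ≤ ∑' i, (a i + a' (π i)) := ENNReal.tsum_le_tsum hle
    _ = ∑' i, a i + ∑' i, a' (π i) := ENNReal.tsum_add
    _ = _ := by rw [π.tsum_eq a', ha, ha', two_mul]

lemma IsDiagonal.mem_traceOrbit [TopologicalSpace.SeparableSpace H]
    (hX : IsDiagonal X b f) (hC : IsDiagonal C c g) (htr : IsTraceClass C)
    (h : ∀ z ≠ 0, {i | f i = z}.encard = {j | g j = z}.encard) :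
    X ∈ traceOrbit C := by
  have := b.orthonormal.countable_of_separableSpace
  have := c.orthonormal.countable_of_separableSpace
  obtain ⟨e, he⟩ := exists_equiv_support_of_encard_fibers_eq h
  have hsum : ∑' i : {i // f i ≠ 0}, ENNReal.ofReal ‖f i‖ ≠ ∞ := by
    have h1 : ∑' i : {i // f i ≠ 0}, ENNReal.ofReal ‖f i‖ = traceNorm C := by
      rw [hC.traceNorm_eq, tsum_ofReal_norm_eq_tsum_support g, ← e.tsum_eq]
      exact tsum_congr fun i => by rw [he]
    rw [h1]; exact htr.ne
  refine ⟨?_, fun ε hε => ?_⟩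
  · rw [IsTraceClass, hX.traceNorm_eq, tsum_ofReal_norm_eq_tsum_support]
    exact hsum.lt_top
  -- The finite set to be matched exactly is chosen so that twice the remaining tail is below `ε`.
  · have ht := ENNReal.tendsto_tsum_compl_atTop_zero hsum
    have ht2 := ENNReal.Tendsto.const_mul (a := 2) ht (Or.inr (by simp))
    rw [mul_zero] at ht2
    obtain ⟨F, hF⟩ := (ht2.eventually (gt_mem_nhds hε)).exists
    obtain ⟨π, hπ⟩ := exists_equiv_extending_of_finite e (b.nonempty_equiv c) F
    obtain ⟨Y, hY, hD⟩ := hX.exists_unitaryOrbit hC π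
    refine ⟨Y, hY, ?_⟩
    rw [hD.traceNorm_eq]
    exact (tsum_ofReal_norm_sub_le e he F π hπ).trans_lt hF

end TraceNorm

/-! ### Listing eigenvalues by decreasing modulus -/

section Enumeration

/-- `r i` counts the elements with key below that of `i`. -/
lemma exists_enumeration {α β : Type*} [LinearOrder β] (key : α → β)
    (hkey : Function.Injective key) (hfin : ∀ i, {j | key j < key i}.Finite) :
    ∃ r : α → ℕ, Function.Injective r ∧ (∀ i j, r j < r i ↔ key j < key i) ∧
      ∀ i, ∀ n < r i, ∃ j, r j = n := by
  classical
  let P : α → Finset α := fun i => (hfin i).toFinset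
  have hP : ∀ i j, j ∈ P i ↔ key j < key i := fun i j => by simp [P]
  have hlt : ∀ i j, key j < key i → (P j).card < (P i).card := by
    intro i j hij
    refine Finset.card_lt_card ⟨fun k hk => ?_, fun hsub => ?_⟩
    · rw [hP] at hk ⊢; exact hk.trans hij
    · exact lt_irrefl _ ((hP j j).1 (hsub ((hP i j).2 hij)))
  have hiff : ∀ i j, (P j).card < (P i).card ↔ key j < key i := by
    refine fun i j => ⟨fun h => ?_, hlt i j⟩
    by_contra hcon
    rcases (not_lt.1 hcon).lt_or_eq with h1 | h1
    · exact lt_asymm h (hlt j i h1)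
    · rw [hkey h1] at h; exact lt_irrefl _ h
  have hinj : Function.Injective fun i => (P i).card := by
    intro i j hij
    rcases lt_trichotomy (key i) (key j) with h | h | h
    · exact absurd hij (hlt _ _ h).ne
    · exact hkey h
    · exact absurd hij (hlt _ _ h).ne'
  refine ⟨fun i => (P i).card, hinj, hiff, fun i n hn => ?_⟩
  have h1 : (P i).image (fun j => (P j).card) = Finset.range (P i).card := by
    refine Finset.eq_of_subset_of_card_le (fun m hm => ?_) ?_
    · obtain ⟨j, hj, rfl⟩ := Finset.mem_image.1 hm
      exact Finset.mem_range.2 (hlt i j ((hP i j).1 hj))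
    · rw [Finset.card_image_of_injective _ hinj, Finset.card_range]
  have h2 : n ∈ (P i).image (fun j => (P j).card) := by
    rw [h1]; exact Finset.mem_range.2 hn
  obtain ⟨j, -, hj⟩ := Finset.mem_image.1 h2
  exact ⟨j, hj⟩

lemma exists_antitone_norm_enumeration {ι : Type*} [Countable ι] {f : ι → ℂ}
    (hf : Tendsto f cofinite (𝓝 0)) :
    ∃ μ : ℕ → ℂ, Antitone (fun n => ‖μ n‖) ∧
      ∀ z ≠ 0, {n | μ n = z}.encard = {i | f i = z}.encard := by
  obtain ⟨φ, hφ⟩ := exists_injective_nat ι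
  -- The sign turns decreasing modulus into increasing keys; `φ` breaks ties.
  let key : {i // f i ≠ 0} → ℝ ×ₗ ℕ := fun i => toLex (-‖f i‖, φ i)
  have hkey : Function.Injective key := by
    intro i j hij
    have h1 : (-‖f i‖, φ i) = (-‖f j‖, φ j) := toLex.injective hij
    exact Subtype.ext (hφ (Prod.ext_iff.1 h1).2)
  have hle : ∀ i j, key j < key i → ‖f i‖ ≤ ‖f j‖ := by
    intro i j hij
    rcases Prod.Lex.toLex_lt_toLex.1 hij with h | ⟨h, -⟩
    · have h : -‖f j‖ < -‖f i‖ := h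
      linarith
    · have h : -‖f j‖ = -‖f i‖ := h
      linarith
  have hfin : ∀ i, {j | key j < key i}.Finite := by
    intro i
    have h1 : {j | ¬ ‖f j‖ < ‖f i‖}.Finite :=
      hf.norm.eventually (gt_mem_nhds (show ‖(0 : ℂ)‖ < ‖f i‖ by simpa using i.2))
    exact (h1.preimage Subtype.val_injective.injOn).subset fun j hj => not_lt.2 (hle i j hj)
  obtain ⟨r, hr, hrlt, hrs⟩ := exists_enumeration key hkey hfin
  have hval : ∀ i, Function.extend r (fun i => f i) 0 (r i) = f i := fun i => hr.extend_apply _ _ i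
  have hval' : ∀ n, (¬ ∃ i, r i = n) → Function.extend r (fun i => f i) 0 n = 0 := fun n hn =>
    Function.extend_apply' _ _ n hn
  -- The range of `r` is an initial segment of `ℕ`, so the default `0` occurs only after all nonzero
  -- values.
  refine ⟨Function.extend r (fun i => f i) 0, ?_, ?_⟩
  · intro m n hmn
    by_cases hn : ∃ i, r i = n
    · obtain ⟨i, rfl⟩ := hn
      rcases hmn.lt_or_eq with h | rfl
      · obtain ⟨j, rfl⟩ := hrs i m h
        simp only [hval]
        exact hle i j ((hrlt i j).1 h)
      · exact le_rfl
    · simp [hval' n hn]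
  · intro z hz
    have h1 : {n | Function.extend r (fun i => f i) 0 n = z} =
        r '' {i | f i = z} := by
      ext n
      constructor
      · intro hn
        by_cases h : ∃ i, r i = n
        · obtain ⟨i, rfl⟩ := h
          exact ⟨i, (hval i).symm.trans hn, rfl⟩
        · exact absurd ((hval' n h).symm.trans hn) hz.symm
      · rintro ⟨i, hi, rfl⟩
        exact (hval i).trans hi
    have h2 : {i | f i = z} = Subtype.val '' {i : {i // f i ≠ 0} | f i = z} := by
      ext i
      constructor
      · intro hi
        exact ⟨⟨i, fun h0 => hz (hi.symm.trans h0)⟩, hi, rfl⟩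
      · rintro ⟨i, hi, rfl⟩
        exact hi
    rw [h1, h2, hr.injOn.encard_image, Subtype.val_injective.injOn.encard_image]

end Enumeration

/-! ### Multiplicities along the orbit and its norm closure -/

section Multiplicity

/-- Every nonzero number has the same geometric multiplicity for `S` and `T`. -/
def SameMultiplicities {E : Type u} {F : Type v} [NormedAddCommGroup E] [InnerProductSpace ℂ E]
    [NormedAddCommGroup F] [InnerProductSpace ℂ F] (S : E →L[ℂ] E) (T : F →L[ℂ] F) : Prop :=
  ∀ z ≠ 0, Cardinal.toENat (Module.rank ℂ (eigenspace (S : End ℂ E) z)) =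
    Cardinal.toENat (Module.rank ℂ (eigenspace (T : End ℂ F) z))

lemma toENat_rank_map_eq {E : Type u} {F : Type v} [AddCommGroup E] [Module ℂ E] [AddCommGroup F]
    [Module ℂ F] {J : E →ₗ[ℂ] F} (hJ : Function.Injective J) (p : Submodule ℂ E) :
    Cardinal.toENat (Module.rank ℂ (p.map J)) = Cardinal.toENat (Module.rank ℂ p) := by
  have := congrArg Cardinal.toENat (Submodule.equivMapOfInjective J hJ p).lift_rank_eq
  rw [Cardinal.toENat_lift, Cardinal.toENat_lift] at this
  exact this.symm

variable {H : Type*} [NormedAddCommGroup H] [InnerProductSpace ℂ H]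

section

variable [CompleteSpace H] [TopologicalSpace.SeparableSpace H] {X C : H →L[ℂ] H}

lemma eigenvalueSequencesAgree_iff (hXc : IsCompactOperator X) (hXn : IsStarNormal X)
    (hCc : IsCompactOperator C) (hCn : IsStarNormal C) :
    EigenvalueSequencesAgree X C ↔ SameMultiplicities X C := by
  obtain ⟨ι, b, f, hX⟩ := exists_isDiagonal hXn hXc
  obtain ⟨κ, c, g, hC⟩ := exists_isDiagonal hCn hCc
  constructor
  · rintro ⟨μ, ν, ⟨-, hμ⟩, ⟨-, hν⟩, σ, rfl⟩ z hz
    have h1 := hμ z hz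
    have h2 := hν z hz
    rw [hX.maxGenEigenspace_eq] at h1
    rw [hC.maxGenEigenspace_eq] at h2
    rw [← h1, ← h2]
    have h3 : {n | (μ ∘ σ) n = z} = σ ⁻¹' {n | μ n = z} := rfl
    rw [h3, ← σ.image_symm_eq_preimage, σ.symm.injective.injOn.encard_image]
  · intro h
    have := b.orthonormal.countable_of_separableSpace
    obtain ⟨μ, hμ, hμz⟩ := exists_antitone_norm_enumeration (hX.tendsto_zero hXc)
    -- A single enumeration, built from the diagonal of `X`, serves both operators.
    refine ⟨μ, μ, ⟨hμ, fun z hz => ?_⟩, ⟨hμ, fun z hz => ?_⟩, Equiv.refl _, rfl⟩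
    · rw [hX.maxGenEigenspace_eq, hμz z hz, hX.toENat_rank_eigenspace]
    · rw [hC.maxGenEigenspace_eq, hμz z hz, ← h z hz, hX.toENat_rank_eigenspace]

end

section

variable [CompleteSpace H] {X C Y : H →L[ℂ] H}

lemma sameMultiplicities_of_mem_unitaryOrbit (h : Y ∈ unitaryOrbit C) :
    SameMultiplicities Y C := by
  obtain ⟨U, hU, rfl⟩ := h
  intro z _
  have h1 : ∀ x, star U (U x) = x := fun x =>
    congrArg (fun T : H →L[ℂ] H => T x) (Unitary.star_mul_self_of_mem hU)
  have h2 : ∀ x, U (star U x) = x := fun x =>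
    congrArg (fun T : H →L[ℂ] H => T x) (Unitary.mul_star_self_of_mem hU)
  have hinj : Function.Injective (U : H →ₗ[ℂ] H) := fun x y hxy => by
    rw [← h1 x, ← h1 y]; exact congrArg (fun y => (star U : H →L[ℂ] H) y) hxy
  have : eigenspace ((U * C * star U : H →L[ℂ] H) : End ℂ H) z =
      (eigenspace (C : End ℂ H) z).map (U : H →ₗ[ℂ] H) := by
    ext x
    rw [mem_eigenspace_iff, Submodule.mem_map]
    change U (C (star U x)) = z • x ↔ _
    constructor
    · intro hx
      refine ⟨star U x, mem_eigenspace_iff.2 ?_, h2 x⟩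
      change C (star U x) = z • star U x
      rw [← h1 (C (star U x)), hx, map_smul]
    · rintro ⟨y, hy, rfl⟩
      have hy : C y = z • y := mem_eigenspace_iff.1 hy
      change U (C (star U (U y))) = z • U y
      rw [h1, hy, map_smul]
  rw [this, toENat_rank_map_eq hinj]

lemma isCompactOperator_of_mem_unitaryOrbit (h : Y ∈ unitaryOrbit C)
    (hC : IsCompactOperator C) : IsCompactOperator Y := by
  obtain ⟨U, hU, rfl⟩ := h
  exact (hC.clm_comp U).comp_clm (star U)

lemma isStarNormal_of_mem_unitaryOrbit (h : Y ∈ unitaryOrbit C)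
    (hC : IsStarNormal C) : IsStarNormal Y := by
  obtain ⟨U, hU, rfl⟩ := h
  have h1 := Unitary.star_mul_self_of_mem hU
  have h2 : star C * C = C * star C := hC.star_comm_self
  have key : ∀ A B : H →L[ℂ] H, U * A * star U * (U * B * star U) = U * (A * B) * star U := by
    intro A B
    calc U * A * star U * (U * B * star U) = U * A * (star U * U) * B * star U := by
          simp only [mul_assoc]
      _ = _ := by rw [h1, mul_one]; simp only [mul_assoc]
  refine ⟨?_⟩
  have h3 : star (U * C * star U) = U * star C * star U := by
    simp only [star_mul, star_star, mul_assoc]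
  rw [Commute, SemiconjBy, h3, key, key, h2]

lemma isCompactOperator_of_mem_closure (h : X ∈ closure (unitaryOrbit C))
    (hC : IsCompactOperator C) : IsCompactOperator X :=
  closure_minimal (fun _ hY => isCompactOperator_of_mem_unitaryOrbit hY hC)
    isClosed_setOfPred_isCompactOperator h

lemma isStarNormal_of_mem_closure (h : X ∈ closure (unitaryOrbit C))
    (hC : IsStarNormal C) : IsStarNormal X := by
  have hcl : IsClosed {X : H →L[ℂ] H | star X * X = X * star X} :=
    isClosed_eq (continuous_star.mul continuous_id) (continuous_id.mul continuous_star)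
  have := closure_minimal (fun Y hY =>
    ((isStarNormal_of_mem_unitaryOrbit hY hC).star_comm_self : star Y * Y = Y * star Y)) hcl h
  exact ⟨this⟩

lemma sameMultiplicities_of_mem_closure (h : X ∈ closure (unitaryOrbit C))
    (hCc : IsCompactOperator C) (hCn : IsStarNormal C) : SameMultiplicities X C := by
  have hXc := isCompactOperator_of_mem_closure h hCc
  obtain ⟨ι, b, f, hX⟩ := exists_isDiagonal (isStarNormal_of_mem_closure h hCn) hXc
  obtain ⟨κ, c, g, hC⟩ := exists_isDiagonal hCn hCc
  intro z hz
  obtain ⟨δ, hδ, hδX⟩ := hX.exists_rank_eigenspace_le hXc hz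
  obtain ⟨δ', hδ', hδC⟩ := hC.exists_rank_eigenspace_le hCc hz
  obtain ⟨Y, hY, hXY⟩ := Metric.mem_closure_iff.1 h (min δ δ') (lt_min hδ hδ')
  rw [dist_eq_norm] at hXY
  refine le_antisymm ?_ ?_
  · obtain ⟨U, hU, rfl⟩ := hY
    -- Conjugating back moves `X` as close to `C` as `U C U*` is to `X`, so semicontinuity at `C`
    -- applies.
    have hZ : star U * X * star (star U) ∈ unitaryOrbit X := ⟨star U, Unitary.star_mem hU, rfl⟩
    have h1 := Unitary.star_mul_self_of_mem hU
    have h2 : star U * (U * C * star U - X) * U = C - star U * X * star (star U) := by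
      have : star U * (U * C * star U) * U = C := by
        calc _ = (star U * U) * C * (star U * U) := by simp only [mul_assoc]
          _ = C := by rw [h1, one_mul, mul_one]
      rw [mul_sub, sub_mul, this, star_star]
    rw [← sameMultiplicities_of_mem_unitaryOrbit hZ z hz]
    refine hδC _ ?_
    rw [← h2, CStarRing.norm_mul_mem_unitary _ hU,
      CStarRing.norm_mem_unitary_mul _ (Unitary.star_mem hU), norm_sub_rev]
    exact hXY.trans_le (min_le_right _ _)
  · rw [← sameMultiplicities_of_mem_unitaryOrbit hY z hz]
    exact hδX Y (hXY.trans_le (min_le_left _ _))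

end

end Multiplicity

/-! ### Direct sums with an infinite-dimensional zero operator -/

section DirectSum

variable {H : Type u} [NormedAddCommGroup H] [InnerProductSpace ℂ H]
  {K : Type v} [NormedAddCommGroup K] [InnerProductSpace ℂ K]

variable (H K) in
/-- The inclusion of the first summand into the Hilbert space direct sum. -/
noncomputable def inlL : H →L[ℂ] WithLp 2 (H × K) :=
  (WithLp.prodContinuousLinearEquiv 2 ℂ H K).symm.toContinuousLinearMap ∘L
    ContinuousLinearMap.inl ℂ H K

variable (H K) in
/-- The projection of the Hilbert space direct sum onto the first summand. -/
noncomputable def fstL : WithLp 2 (H × K) →L[ℂ] H :=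
  ContinuousLinearMap.fst ℂ H K ∘L (WithLp.prodContinuousLinearEquiv 2 ℂ H K).toContinuousLinearMap

lemma directSum_zero_eq (X : H →L[ℂ] H) :
    directSum X (0 : K →L[ℂ] K) = inlL H K ∘L X ∘L fstL H K := rfl

lemma eq_fstL_directSum_inlL (X : H →L[ℂ] H) :
    X = fstL H K ∘L directSum X (0 : K →L[ℂ] K) ∘L inlL H K := rfl

lemma inlL_injective : Function.Injective (inlL H K) := fun _ _ h =>
  congrArg (fstL H K) h

lemma isCompactOperator_directSum_zero_iff {X : H →L[ℂ] H} :
    IsCompactOperator (directSum X (0 : K →L[ℂ] K)) ↔ IsCompactOperator X := by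
  constructor
  · intro h
    rw [eq_fstL_directSum_inlL (K := K) X]
    exact (h.comp_clm (inlL H K)).clm_comp (fstL H K)
  · intro h
    rw [directSum_zero_eq]
    exact (h.comp_clm (fstL H K)).clm_comp (inlL H K)

lemma norm_directSum_zero_apply (X : H →L[ℂ] H) (v : WithLp 2 (H × K)) :
    ‖directSum X (0 : K →L[ℂ] K) v‖ = ‖X v.fst‖ := by
  have h := WithLp.prod_norm_sq_eq_of_L2 (directSum X (0 : K →L[ℂ] K) v)
  have h1 : (directSum X (0 : K →L[ℂ] K) v).fst = X v.fst := rfl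
  have h2 : (directSum X (0 : K →L[ℂ] K) v).snd = 0 := rfl
  rw [h1, h2, norm_zero] at h
  exact (sq_eq_sq₀ (norm_nonneg _) (norm_nonneg _)).1 (by linarith)

lemma isStarNormal_directSum_zero_iff [CompleteSpace H] [CompleteSpace K] {X : H →L[ℂ] H} :
    IsStarNormal (directSum X (0 : K →L[ℂ] K)) ↔ IsStarNormal X := by
  have hadj : adjoint (directSum X (0 : K →L[ℂ] K)) = directSum (adjoint X) 0 := by
    symm
    rw [eq_adjoint_iff]
    intro v w
    rw [WithLp.prod_inner_apply, WithLp.prod_inner_apply]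
    change ⟪adjoint X v.fst, w.fst⟫_ℂ + ⟪(0 : K), w.snd⟫_ℂ =
      ⟪v.fst, X w.fst⟫_ℂ + ⟪v.snd, (0 : K)⟫_ℂ
    rw [inner_zero_left, inner_zero_right, adjoint_inner_left]
  rw [isStarNormal_iff_norm_eq_adjoint, isStarNormal_iff_norm_eq_adjoint, hadj]
  simp only [norm_directSum_zero_apply]
  exact ⟨fun h v => h (inlL H K v), fun h v => h v.fst⟩

lemma sameMultiplicities_directSum_zero (X : H →L[ℂ] H) :
    SameMultiplicities (directSum X (0 : K →L[ℂ] K)) X := by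
  intro z hz
  have : eigenspace (directSum X (0 : K →L[ℂ] K) : End ℂ (WithLp 2 (H × K))) z =
      (eigenspace (X : End ℂ H) z).map (inlL H K : H →ₗ[ℂ] WithLp 2 (H × K)) := by
    ext v
    rw [mem_eigenspace_iff, Submodule.mem_map]
    constructor
    · intro hv
      have h1 : X v.fst = z • v.fst := congrArg (fun w : WithLp 2 (H × K) => w.fst) hv
      have h2 : (0 : K) = z • v.snd := congrArg (fun w : WithLp 2 (H × K) => w.snd) hv
      refine ⟨v.fst, mem_eigenspace_iff.2 h1, ?_⟩
      have h3 : v.snd = 0 := by simpa [hz] using h2.symm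
      have h4 : v = WithLp.toLp 2 (v.fst, v.snd) := rfl
      rw [h4, h3]
      rfl
    · rintro ⟨y, hy, rfl⟩
      have hy : X y = z • y := mem_eigenspace_iff.1 hy
      change inlL H K (X y) = z • inlL H K y
      rw [hy, map_smul]
  rw [this]
  exact toENat_rank_map_eq (J := (inlL H K : H →ₗ[ℂ] WithLp 2 (H × K))) inlL_injective _

lemma toENat_rank_ker_directSum_zero (hK : ¬ FiniteDimensional ℂ K) (X : H →L[ℂ] H) :
    Cardinal.toENat (Module.rank ℂ
      (eigenspace (directSum X (0 : K →L[ℂ] K) : End ℂ (WithLp 2 (H × K))) 0)) = ⊤ := by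
  let L : K →ₗ[ℂ] eigenspace (directSum X (0 : K →L[ℂ] K) : End ℂ (WithLp 2 (H × K))) 0 :=
    LinearMap.codRestrict _
      ((WithLp.prodContinuousLinearEquiv 2 ℂ H K).symm.toLinearMap ∘ₗ LinearMap.inr ℂ H K) (by
        intro k
        rw [mem_eigenspace_iff, zero_smul]
        change WithLp.toLp 2 (X 0, (0 : K)) = 0
        rw [map_zero]
        rfl)
  have hL : Function.Injective L := fun x y h =>
    congrArg (fun w : eigenspace (directSum X (0 : K →L[ℂ] K) : End ℂ (WithLp 2 (H × K))) 0 =>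
      (w : WithLp 2 (H × K)).snd) h
  have h1 := LinearMap.lift_rank_le_of_injective L hL
  have h2 := OrderHomClass.mono Cardinal.toENat h1
  rw [Cardinal.toENat_lift, Cardinal.toENat_lift] at h2
  have h3 : Cardinal.toENat (Module.rank ℂ K) = ⊤ := by
    rw [Cardinal.toENat_eq_top]
    by_contra hlt
    exact hK (Module.rank_lt_aleph0_iff.1 (not_le.1 hlt))
  rw [h3] at h2
  exact top_le_iff.1 h2

variable [CompleteSpace H] [TopologicalSpace.SeparableSpace H] [CompleteSpace K]
  [TopologicalSpace.SeparableSpace K] {X C : H →L[ℂ] H}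

/-- Both kernels are infinite-dimensional, so equal nonzero multiplicities already match the whole
diagonals and the unitary equivalence is exact. -/
lemma directSum_zero_mem_unitaryOrbit_iff (hK : ¬ FiniteDimensional ℂ K)
    (hCc : IsCompactOperator C) (hCn : IsStarNormal C) :
    directSum X (0 : K →L[ℂ] K) ∈ unitaryOrbit (directSum C (0 : K →L[ℂ] K)) ↔
      IsCompactOperator X ∧ IsStarNormal X ∧ SameMultiplicities X C := by
  have hCc' := (isCompactOperator_directSum_zero_iff (K := K)).2 hCc
  have hCn' := (isStarNormal_directSum_zero_iff (K := K)).2 hCn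
  constructor
  · intro h
    refine ⟨isCompactOperator_directSum_zero_iff.1 (isCompactOperator_of_mem_unitaryOrbit h hCc'),
      isStarNormal_directSum_zero_iff.1 (isStarNormal_of_mem_unitaryOrbit h hCn'), fun z hz => ?_⟩
    rw [← sameMultiplicities_directSum_zero (K := K) X z hz,
      sameMultiplicities_of_mem_unitaryOrbit h z hz, sameMultiplicities_directSum_zero C z hz]
  · rintro ⟨hXc, hXn, hXC⟩
    obtain ⟨ι, b, f, hX⟩ := exists_isDiagonal
      ((isStarNormal_directSum_zero_iff (K := K)).2 hXn)
      ((isCompactOperator_directSum_zero_iff (K := K)).2 hXc)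
    obtain ⟨κ, c, g, hC⟩ := exists_isDiagonal hCn' hCc'
    have hsep : TopologicalSpace.SeparableSpace (WithLp 2 (H × K)) :=
      (WithLp.prodContinuousLinearEquiv 2 ℂ H K).symm.surjective.denseRange.separableSpace
        (WithLp.prodContinuousLinearEquiv 2 ℂ H K).symm.continuous
    have := b.orthonormal.countable_of_separableSpace
    have := c.orthonormal.countable_of_separableSpace
    refine hX.mem_unitaryOrbit hC fun z => ?_
    rw [← hX.toENat_rank_eigenspace, ← hC.toENat_rank_eigenspace]
    by_cases hz : z = 0
    · rw [hz, toENat_rank_ker_directSum_zero hK, toENat_rank_ker_directSum_zero hK]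
    · rw [sameMultiplicities_directSum_zero X z hz, sameMultiplicities_directSum_zero C z hz,
        hXC z hz]

end DirectSum

/-! ### Finite-rank operators: the orbit is norm closed -/

section FiniteRank

variable {H : Type*} [NormedAddCommGroup H] [InnerProductSpace ℂ H]

lemma isCompactOperator_of_finiteDimensional_range {C : H →L[ℂ] H}
    (h : FiniteDimensional ℂ (LinearMap.range (C : H →ₗ[ℂ] H))) : IsCompactOperator C := by
  have hid : IsCompactOperator (id : LinearMap.range (C : H →ₗ[ℂ] H) → _) :=
    isCompactOperator_id_iff_finiteDimensional.2 h
  exact (hid.comp_clm (C.codRestrict (LinearMap.range (C : H →ₗ[ℂ] H))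
    fun x => LinearMap.mem_range_self _ x)).clm_comp
      (LinearMap.range (C : H →ₗ[ℂ] H)).subtypeL

variable [CompleteSpace H]

/-- An orthonormal basis of `M` and its image both extend to Hilbert bases of `H`, and the finite
matching between them extends to all indices. Finite dimension matters: a unilateral shift has no
unitary extension. -/
lemma _root_.LinearIsometry.exists_unitary_extension [TopologicalSpace.SeparableSpace H]
    {M : Submodule ℂ H} [FiniteDimensional ℂ M] (V : M →ₗᵢ[ℂ] H) :
    ∃ U ∈ unitary (H →L[ℂ] H), ∀ m : M, U m = V m := by
  let e := stdOrthonormalBasis ℂ M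
  have h1 : Orthonormal ℂ (fun j => (e j : H)) := e.orthonormal.comp_linearIsometry M.subtypeₗᵢ
  have h2 : Orthonormal ℂ (fun j => V (e j)) := e.orthonormal.comp_linearIsometry V
  obtain ⟨w₁, b, hw₁, hb⟩ := h1.toSubtypeRange.exists_hilbertBasis_extension
  obtain ⟨w₂, c, hw₂, hc⟩ := h2.toSubtypeRange.exists_hilbertBasis_extension
  obtain ⟨π, hπ⟩ := exists_equiv_extending
    (p := fun j => (⟨e j, hw₁ ⟨j, rfl⟩⟩ : w₁)) (q := fun j => (⟨V (e j), hw₂ ⟨j, rfl⟩⟩ : w₂))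
    (fun i j hij => h1.linearIndependent.injective (Subtype.mk.inj hij))
    (fun i j hij => h2.linearIndependent.injective (Subtype.mk.inj hij)) (b.nonempty_equiv c)
  obtain ⟨U, hU, hUb⟩ := b.exists_unitary c π
  refine ⟨U, hU, fun m => ?_⟩
  have hE : (U : H →ₗ[ℂ] H) ∘ₗ M.subtype = V.toLinearMap := by
    refine e.toBasis.ext fun j => ?_
    have h3 := hUb ⟨e j, hw₁ ⟨j, rfl⟩⟩
    rw [hπ j, hb, hc] at h3
    simpa using h3
  exact congrArg (fun L : M →ₗ[ℂ] H => L m) hE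

/-- `C*` vanishes on `(ran C)ᗮ`, so its range is already the image of `ran C`. -/
lemma finiteDimensional_range_adjoint {C : H →L[ℂ] H}
    (h : FiniteDimensional ℂ (LinearMap.range (C : H →ₗ[ℂ] H))) :
    FiniteDimensional ℂ (LinearMap.range (adjoint C : H →ₗ[ℂ] H)) := by
  have hle : LinearMap.range (adjoint C : H →ₗ[ℂ] H) ≤
      (LinearMap.range (C : H →ₗ[ℂ] H)).map (adjoint C : H →ₗ[ℂ] H) := by
    rintro _ ⟨y, rfl⟩
    obtain ⟨p, hp, q, hq, rfl⟩ :=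
      (LinearMap.range (C : H →ₗ[ℂ] H)).exists_add_mem_mem_orthogonal y
    refine ⟨p, hp, ?_⟩
    have h0 : adjoint C q = 0 := by
      refine ext_inner_right ℂ fun x => ?_
      rw [adjoint_inner_left, inner_zero_left, inner_eq_zero_symm]
      exact hq _ ⟨x, rfl⟩
    change adjoint C p = adjoint C (p + q)
    rw [map_add, h0, add_zero]
  exact Submodule.finiteDimensional_of_le hle

lemma isTraceClass_of_finiteDimensional_range {C : H →L[ℂ] H}
    (h : FiniteDimensional ℂ (LinearMap.range (C : H →ₗ[ℂ] H))) : IsTraceClass C := by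
  have hfd := finiteDimensional_range_adjoint h
  have hc : IsCompactOperator (adjoint C * C : H →L[ℂ] H) :=
    (isCompactOperator_of_finiteDimensional_range h).clm_comp (adjoint C)
  obtain ⟨ι, b, t, hb⟩ := exists_isDiagonal
    (T := adjoint C * C) (IsSelfAdjoint.star_mul_self C).isStarNormal hc
  have hb' : ∀ i, adjoint C (C (b i)) = t i • b i := hb
  -- Eigenvectors of `C* C` with nonzero eigenvalue lie in `ran C*`; `C` kills the other basis
  -- vectors.
  have hfin : {i | t i ≠ 0}.Finite := by
    have hli : LinearIndependent ℂ fun i : {i | t i ≠ 0} =>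
        (⟨b i, (t i)⁻¹ • C (b i), by
          change adjoint C ((t i)⁻¹ • C (b i)) = _
          rw [map_smul, hb', smul_smul, inv_mul_cancel₀ i.2, one_smul]⟩ :
          LinearMap.range (adjoint C : H →ₗ[ℂ] H)) := by
      refine LinearIndependent.of_comp (Submodule.subtype _) ?_
      exact b.orthonormal.linearIndependent.comp _ Subtype.val_injective
    exact Set.finite_coe_iff.1 hli.finite
  refine (traceNorm_le_tsum_norm C b).trans_lt ?_
  rw [tsum_eq_sum (s := hfin.toFinset)]
  · exact ENNReal.sum_lt_top.2 fun i _ => ENNReal.ofReal_lt_top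
  · intro i hi
    have ht : t i = 0 := by simpa using hi
    have h1 : ⟪C (b i), C (b i)⟫_ℂ = 0 := by
      rw [← adjoint_inner_right, hb', ht, zero_smul, inner_zero_right]
    rw [inner_self_eq_zero.1 h1]; simp

/-- If the conjugates `U n * A * (U n)⁻¹` converge to a compact operator, then `U n` converges on
the range of `A` along every ultrafilter finer than `atTop`. -/
lemma exists_tendsto_apply_of_tendsto_conj {A X : H →L[ℂ] H} {U : ℕ → H →L[ℂ] H}
    (hU : ∀ n, U n ∈ unitary (H →L[ℂ] H)) (hX : IsCompactOperator X)
    (hlim : Tendsto (fun n => U n * A * star (U n)) atTop (𝓝 X)) (𝒰 : Ultrafilter ℕ)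
    (h𝒰 : (𝒰 : Filter ℕ) ≤ atTop) (y : H) : ∃ v, Tendsto (fun n => U n (A y)) 𝒰 (𝓝 v) := by
  obtain ⟨K, hK, hXK⟩ := hX.image_closedBall_subset_compact ‖y‖
  have hnorm : ∀ n, ‖U n y‖ = ‖y‖ := fun n => norm_map_of_mem_unitary (hU n) y
  have hmem : ∀ n, X (U n y) ∈ K := fun n => hXK ⟨U n y, by simp [hnorm], rfl⟩
  obtain ⟨v, -, hv⟩ := hK.ultrafilter_le_nhds (𝒰.map fun n => X (U n y))
    (le_principal_iff.2 (Ultrafilter.mem_map.2 (Eventually.of_forall hmem)))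
  have hv : Tendsto (fun n => X (U n y)) 𝒰 (𝓝 v) := hv
  -- `U n (A y)` is the conjugate `U n A (U n)*` applied to `U n y`, hence asymptotic to `X (U n
  -- y)`, which converges by compactness.
  have h0 : Tendsto (fun n => (U n * A * star (U n) - X) (U n y)) 𝒰 (𝓝 0) := by
    have h1 := (tendsto_iff_norm_sub_tendsto_zero.1 hlim).mul_const ‖y‖
    rw [zero_mul] at h1
    refine squeeze_zero_norm (fun n => ?_) (h1.mono_left h𝒰)
    exact (le_opNorm _ _).trans_eq (by rw [hnorm])
  refine ⟨v, ?_⟩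
  have h2 := h0.add hv
  rw [zero_add] at h2
  refine h2.congr fun n => ?_
  have h3 : star (U n) (U n y) = y := star_apply_of_apply_eq (hU n) rfl
  rw [sub_apply, sub_add_cancel]
  change U n (A (star (U n) (U n y))) = _
  rw [h3]

lemma mem_unitaryOrbit_of_mem_closure [TopologicalSpace.SeparableSpace H] {C X : H →L[ℂ] H}
    (hC : FiniteDimensional ℂ (LinearMap.range (C : H →ₗ[ℂ] H)))
    (hX : X ∈ closure (unitaryOrbit C)) : X ∈ unitaryOrbit C := by
  have hC' := finiteDimensional_range_adjoint hC
  obtain ⟨Y, hY, hlim⟩ := mem_closure_iff_seq_limit.1 hX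
  choose U hU hYU using hY
  obtain rfl : Y = fun n => U n * C * star (U n) := funext hYU
  have hlim' : Tendsto (fun n => U n * adjoint C * star (U n)) atTop (𝓝 (star X)) := by
    refine ((continuous_star.tendsto X).comp hlim).congr fun n => ?_
    rw [Function.comp_apply, star_mul, star_mul, star_star, star_eq_adjoint C, mul_assoc]
  have hXc := isCompactOperator_of_mem_closure hX
    (isCompactOperator_of_finiteDimensional_range hC)
  have hXc' : IsCompactOperator (star X : H →L[ℂ] H) := by
    refine isCompactOperator_of_mem_closure (C := adjoint C) ?_
      (isCompactOperator_of_finiteDimensional_range hC')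
    exact mem_closure_of_tendsto hlim' (Eventually.of_forall fun n => ⟨U n, hU n, rfl⟩)
  -- One ultrafilter gives limits for all vectors of `M` at once, with no passage to subsequences.
  let 𝒰 : Ultrafilter ℕ := hyperfilter ℕ
  have h𝒰 : (𝒰 : Filter ℕ) ≤ atTop := Nat.hyperfilter_le_atTop
  set M : Submodule ℂ H :=
    LinearMap.range (C : H →ₗ[ℂ] H) ⊔ LinearMap.range (adjoint C : H →ₗ[ℂ] H) with hM
  have hconv : ∀ m : M, ∃ v, Tendsto (fun n => U n m) 𝒰 (𝓝 v) := by
    rintro ⟨m, hm⟩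
    obtain ⟨_, ⟨y, rfl⟩, _, ⟨z, rfl⟩, rfl⟩ := Submodule.mem_sup.1 hm
    obtain ⟨v, hv⟩ := exists_tendsto_apply_of_tendsto_conj hU hXc hlim 𝒰 h𝒰 y
    obtain ⟨w, hw⟩ := exists_tendsto_apply_of_tendsto_conj hU hXc' hlim' 𝒰 h𝒰 z
    exact ⟨v + w, (hv.add hw).congr fun n => (map_add (U n) _ _).symm⟩
  choose V hV using hconv
  let W : M →ₗᵢ[ℂ] H :=
    { toFun := V
      map_add' := fun x y => tendsto_nhds_unique (hV (x + y))
        (((hV x).add (hV y)).congr fun n => (map_add (U n) _ _).symm)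
      map_smul' := fun a x => tendsto_nhds_unique (hV (a • x))
        (((hV x).const_smul a).congr fun n => (map_smul (U n) _ _).symm)
      norm_map' := fun x => tendsto_nhds_unique (hV x).norm
        (tendsto_const_nhds.congr fun n => (norm_map_of_mem_unitary (hU n) (x : H)).symm) }
  obtain ⟨U₀, hU₀, hU₀W⟩ := W.exists_unitary_extension
  have hlimM : ∀ m ∈ M, Tendsto (fun n => U n m) 𝒰 (𝓝 (U₀ m)) := fun m hm => by
    rw [hU₀W ⟨m, hm⟩]; exact hV ⟨m, hm⟩
  let e := stdOrthonormalBasis ℂ M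
  -- `C` vanishes on `Mᗮ` because `M` contains `ran C*`. As `M` also contains `ran C`, the conjugate
  -- of `C` by `Z` depends only on `Z` restricted to `M`.
  have hCe : ∀ k, C k = ∑ j, ⟪(e j : H), k⟫_ℂ • C (e j) := by
    intro k
    obtain ⟨p, hp, q, hq, rfl⟩ := M.exists_add_mem_mem_orthogonal k
    have hCq : C q = 0 := by
      have h1 : ⟪C q, C q⟫_ℂ = 0 := by
        rw [← adjoint_inner_left]
        exact hq _ (Submodule.mem_sup_right ⟨C q, rfl⟩)
      exact inner_self_eq_zero.1 h1
    have hpe : p = ∑ j, ⟪(e j : H), p⟫_ℂ • (e j : H) := by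
      have := congrArg (Subtype.val) (e.sum_repr' ⟨p, hp⟩)
      simpa using this.symm
    rw [map_add, hCq, add_zero]
    conv_lhs => rw [hpe, map_sum]
    refine Finset.sum_congr rfl fun j _ => ?_
    rw [map_smul, inner_add_right, hq _ (e j).2, add_zero]
  have hconj : ∀ Z ∈ unitary (H →L[ℂ] H), ∀ x, (Z * C * star Z) x =
      ∑ j, ⟪Z (e j : H), x⟫_ℂ • Z (C (e j)) := by
    intro Z _ x
    change Z (C (star Z x)) = _
    rw [hCe, map_sum]
    refine Finset.sum_congr rfl fun j _ => ?_
    rw [map_smul, star_eq_adjoint, adjoint_inner_right]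
  refine ⟨U₀, hU₀, ContinuousLinearMap.ext fun x => ?_⟩
  have h1 : Tendsto (fun n => (U n * C * star (U n)) x) 𝒰 (𝓝 (X x)) :=
    (((ContinuousLinearMap.apply ℂ H x).continuous.tendsto X).comp hlim).mono_left h𝒰
  refine tendsto_nhds_unique h1 ?_
  rw [hconj U₀ hU₀]
  refine Tendsto.congr (fun n => (hconj (U n) (hU n) x).symm) ?_
  refine tendsto_finsetSum _ fun j _ => ?_
  exact ((hlimM _ (e j).2).inner tendsto_const_nhds).smul
    (hlimM _ (Submodule.mem_sup_left ⟨e j, rfl⟩))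

lemma finiteDimensional_range_of_mem_unitaryOrbit {C Y : H →L[ℂ] H} (h : Y ∈ unitaryOrbit C)
    (hC : FiniteDimensional ℂ (LinearMap.range (C : H →ₗ[ℂ] H))) :
    FiniteDimensional ℂ (LinearMap.range (Y : H →ₗ[ℂ] H)) := by
  obtain ⟨U, -, rfl⟩ := h
  have hle : LinearMap.range ((U * C * star U : H →L[ℂ] H) : H →ₗ[ℂ] H) ≤
      (LinearMap.range (C : H →ₗ[ℂ] H)).map (U : H →ₗ[ℂ] H) := by
    rintro _ ⟨x, rfl⟩
    exact ⟨C (star U x), ⟨star U x, rfl⟩, rfl⟩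
  exact Submodule.finiteDimensional_of_le hle

end FiniteRank

end OrbitClosure

/-! ### The main theorem -/

open OrbitClosure in
theorem mainTheorem12
    {H : Type*} [NormedAddCommGroup H] [InnerProductSpace ℂ H] [CompleteSpace H]
    [TopologicalSpace.SeparableSpace H]
    {K : Type*} [NormedAddCommGroup K] [InnerProductSpace ℂ K] [CompleteSpace K]
    [TopologicalSpace.SeparableSpace K] (hK : ¬ FiniteDimensional ℂ K)
    (C : H →L[ℂ] H) :
    (IsCompactOperator C → IsStarNormal C → ∀ X : H →L[ℂ] H,
      List.TFAE
        [X ∈ closure (OrbitClosure.unitaryOrbit C),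
         IsCompactOperator X ∧ IsStarNormal X ∧ OrbitClosure.EigenvalueSequencesAgree X C,
         OrbitClosure.directSum X (0 : K →L[ℂ] K) ∈
          OrbitClosure.unitaryOrbit (OrbitClosure.directSum C (0 : K →L[ℂ] K))] ∧
      (OrbitClosure.IsTraceClass C →
        List.TFAE
          [X ∈ closure (OrbitClosure.unitaryOrbit C),
           IsCompactOperator X ∧ IsStarNormal X ∧ OrbitClosure.EigenvalueSequencesAgree X C,
           OrbitClosure.directSum X (0 : K →L[ℂ] K) ∈
            OrbitClosure.unitaryOrbit (OrbitClosure.directSum C (0 : K →L[ℂ] K)),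
           X ∈ OrbitClosure.traceOrbit C])) ∧
    (FiniteDimensional ℂ (LinearMap.range (C : H →ₗ[ℂ] H)) →
      closure (OrbitClosure.unitaryOrbit C) = OrbitClosure.traceOrbit C ∧
      OrbitClosure.traceOrbit C = OrbitClosure.unitaryOrbit C ∧
      ∀ A : H →L[ℂ] H,
        OrbitClosure.orbitClosedNumericalRange C A = OrbitClosure.numericalRange C A) := by
  refine ⟨fun hCc hCn X => ?_, fun hC => ?_⟩
  · have h12 : X ∈ closure (unitaryOrbit C) ↔
        IsCompactOperator X ∧ IsStarNormal X ∧ SameMultiplicities X C := by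
      refine ⟨fun h => ⟨isCompactOperator_of_mem_closure h hCc, isStarNormal_of_mem_closure h hCn,
        sameMultiplicities_of_mem_closure h hCc hCn⟩, ?_⟩
      rintro ⟨hXc, hXn, h⟩
      obtain ⟨ι, b, f, hX⟩ := exists_isDiagonal hXn hXc
      obtain ⟨κ, c, g, hC⟩ := exists_isDiagonal hCn hCc
      refine hX.mem_closure_unitaryOrbit hC (hX.tendsto_zero hXc) fun z hz => ?_
      rw [← hX.toENat_rank_eigenspace, ← hC.toENat_rank_eigenspace, h z hz]
    have h22 : (IsCompactOperator X ∧ IsStarNormal X ∧ EigenvalueSequencesAgree X C) ↔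
        IsCompactOperator X ∧ IsStarNormal X ∧ SameMultiplicities X C :=
      and_congr_right fun hXc => and_congr_right fun hXn =>
        eigenvalueSequencesAgree_iff hXc hXn hCc hCn
    have h32 := directSum_zero_mem_unitaryOrbit_iff (X := X) hK hCc hCn
    rw [h12, h22, h32]
    refine ⟨by tfae_finish, fun htr => ?_⟩
    have h42 : X ∈ traceOrbit C ↔
        IsCompactOperator X ∧ IsStarNormal X ∧ SameMultiplicities X C := by
      refine ⟨fun h => h12.1 (traceOrbit_subset_closure C h), ?_⟩
      rintro ⟨hXc, hXn, h⟩
      obtain ⟨ι, b, f, hX⟩ := exists_isDiagonal hXn hXc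
      obtain ⟨κ, c, g, hC⟩ := exists_isDiagonal hCn hCc
      refine hX.mem_traceOrbit hC htr fun z hz => ?_
      rw [← hX.toENat_rank_eigenspace, ← hC.toENat_rank_eigenspace, h z hz]
    rw [h42]
    tfae_finish
  -- The three sets are squeezed: orbit inside trace-norm closure inside norm closure inside orbit.
  · have h1 : unitaryOrbit C ⊆ traceOrbit C := fun Y hY =>
      ⟨isTraceClass_of_finiteDimensional_range (finiteDimensional_range_of_mem_unitaryOrbit hY hC),
        fun ε hε => ⟨Y, hY, by rwa [sub_self, traceNorm_zero]⟩⟩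
    have h2 : closure (unitaryOrbit C) ⊆ unitaryOrbit C := fun Y hY =>
      mem_unitaryOrbit_of_mem_closure hC hY
    have h3 : traceOrbit C = unitaryOrbit C :=
      ((traceOrbit_subset_closure C).trans h2).antisymm h1
    refine ⟨(h2.trans h1).antisymm (traceOrbit_subset_closure C), h3, fun A => ?_⟩
    rw [orbitClosedNumericalRange, numericalRange, h3]
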